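/- Let $P\subseteq\mathbb R^m$ (the parameter values considered) and $M\subseteq\mathbb R^n$ be open, and let $\phi:P\times M\to\mathbb R^n$, $(\vec C,\vec s)\mapsto\phi^{\vec C}(\vec s)$, be a jointly $C^2$ family of maps such that each $\phi^{\vec C}$ is a diffeomorphism of $M$ onto its image (for example, a smooth $m$-parameter flow $\phi^{\vec B+\vec C}=\phi^{\vec B}\circ\phi^{\vec C}$ of $M$, with $P=\mathbb R^m$). Let $\Omega_0\subseteq M$ be a compact $n$-dimensional submanifold with boundary of class $C^1$, and let $\Omega(\vec C)=\phi^{\vec C}(\Omega_0)$ be the moving domain. Denote by $\nabla_{\vec C}\vec X$ the $m\times n$ matrix field whose value at $\vec X=\phi^{\vec C}(\vec s)$ has the entries $(\nabla_{\vec C}\vec X)_{cj}=\partial\phi^{\vec C}_j(\vec s)/\partial C_c$ ($\vec s$ fixed). Let $b(\vec X,\vec C)$ be a real-valued density which is continuously differentiable in $(\vec X,\vec C)$ on $\{(\vec X,\vec C):\vec C\in P,\ \vec X\in\Omega(\vec C)\}$, up to the boundary of $\Omega(\vec C)$. Then, for every $\vec C\in P$, all the integrals below converge absolutely, the function $\vec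 C\mapsto\int_{\Omega(\vec C)}b\,d^n\vec X$ is differentiable at $\vec C$, and its total differential is $$ d\int_{\Omega(\vec C)} b\,d^n\vec X =\Bigl[\int_{\Omega(\vec C)}\nabla_{\vec C}b\,d^n\vec X+\oint_{\partial\Omega(\vec C)}b\,(\nabla_{\vec C}\vec X)^\top\cdot d^{n-1}\vec X\Bigr]\cdot d\vec C =\Bigl[\int_{\Omega(\vec C)}\bigl(\nabla_{\vec C}b+\nabla_{\vec X}\cdot\{b\,(\nabla_{\vec C}\vec X)^\top\}\bigr)\,d^n\vec X\Bigr]\cdot d\vec C . $$ Here $d^{n-1}\vec X=\vec n\,dS$, with $\vec n$ the outward unit normal and $dS$ the $(n-1)$-dimensional surface measure; $(\nabla_{\vec C}\vec X)^\top\cdot d^{n-1}\vec X$ is the vector in $\mathbb R^m$ with components $\sum_j(\partial X_j/\partial C_c)\,n_j\,dS$; and $\nabla_{\vec X}\cdot\{b(\nabla_{\vec C}\vec X)^\top\}$ is the vector in $\mathbb R^m$ with components $\sum_j\partial\bigl(b\,\partial X_j/\partial C_c\bigr)/\partial X_j$. -/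

import Mathlib

open MeasureTheory
open scoped Topology

/-- `ρ` is a local `C¹` defining function of the set `Ω ⊆ ℝⁿ` at the point `x`: near `x` the set `Ω`
is the sublevel set `{ρ ≤ 0}`, `ρ` vanishes at `x`, and its gradient there is nonzero. -/
def IsLocalDefiningFunction {n : ℕ} (Ω : Set (EuclideanSpace ℝ (Fin n)))
    (x : EuclideanSpace ℝ (Fin n)) (ρ : EuclideanSpace ℝ (Fin n) → ℝ) : Prop :=
  ∃ U : Set (EuclideanSpace ℝ (Fin n)), IsOpen U ∧ x ∈ U ∧ ContDiffOn ℝ 1 ρ U ∧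
    ρ x = 0 ∧ gradient ρ x ≠ 0 ∧ Ω ∩ U = {y ∈ U | ρ y ≤ 0}

/-- A compact `n`-dimensional submanifold with (possibly empty) boundary, of class `C¹`, of `ℝⁿ`;
it carries the standard orientation of `ℝⁿ`. -/
structure IsCompactC1Domain {n : ℕ} (Ω : Set (EuclideanSpace ℝ (Fin n))) : Prop where
  isCompact : IsCompact Ω
  boundary : ∀ x ∈ frontier Ω, ∃ ρ, IsLocalDefiningFunction Ω x ρ

/-- `ν` is the outward unit normal of `Ω` at `x`: the normalized gradient of a local defining
function. -/
def IsOutwardUnitNormal {n : ℕ} (Ω : Set (EuclideanSpace ℝ (Fin n)))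
    (x ν : EuclideanSpace ℝ (Fin n)) : Prop :=
  ∃ ρ, IsLocalDefiningFunction Ω x ρ ∧ ν = ‖gradient ρ x‖⁻¹ • gradient ρ x

open Classical in
/-- The outward unit normal of `Ω` at a boundary point `x` (and `0` where there is none). -/
noncomputable def outwardUnitNormal {n : ℕ} (Ω : Set (EuclideanSpace ℝ (Fin n)))
    (x : EuclideanSpace ℝ (Fin n)) : EuclideanSpace ℝ (Fin n) :=
  if h : ∃ ν, IsOutwardUnitNormal Ω x ν then h.choose else 0

/-- The outward unit normal does not depend on the defining function. -/
theorem IsOutwardUnitNormal.unique {n : ℕ} {Ω : Set (EuclideanSpace ℝ (Fin n))}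
    {x ν₁ ν₂ : EuclideanSpace ℝ (Fin n)} (h₁ : IsOutwardUnitNormal Ω x ν₁)
    (h₂ : IsOutwardUnitNormal Ω x ν₂) : ν₁ = ν₂ := by
  have key : ∀ ρ : EuclideanSpace ℝ (Fin n) → ℝ, IsLocalDefiningFunction Ω x ρ →
      ∀ v : EuclideanSpace ℝ (Fin n),
      (inner ℝ (gradient ρ x) v < 0 → ∀ᶠ t : ℝ in 𝓝[>] 0, x + t • v ∈ Ω) ∧
      (0 < inner ℝ (gradient ρ x) v → ∀ᶠ t : ℝ in 𝓝[>] 0, x + t • v ∉ Ω) := by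
    rintro ρ ⟨U, hU, hxU, hρ, h0, -, hΩ⟩ v
    have hd : HasGradientAt ρ (gradient ρ x) x :=
      ((hρ.contDiffAt (hU.mem_nhds hxU)).differentiableAt (by simp)).hasGradientAt
    have hl : HasDerivAt (fun t : ℝ => x + t • v) v 0 := by
      simpa using ((hasDerivAt_id (0 : ℝ)).smul_const v).const_add x
    have hc : HasDerivAt (fun t : ℝ => ρ (x + t • v)) (inner ℝ (gradient ρ x) v) 0 := by
      have h1 : HasFDerivAt ρ (InnerProductSpace.toDual ℝ _ (gradient ρ x))
        (x + (0 : ℝ) • v) := by simpa using hd.hasFDerivAt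
      exact (h1.comp_hasDerivAt (0 : ℝ) hl).congr_deriv (by simp)
    have hU' : ∀ᶠ t : ℝ in 𝓝[>] 0, x + t • v ∈ U :=
      (hl.continuousAt.eventually_mem (hU.mem_nhds (by simpa using hxU))).filter_mono
        nhdsWithin_le_nhds
    have hs := hasDerivAt_iff_tendsto_slope.1 hc
    have hs' := hs.mono_left (nhdsWithin_mono (0 : ℝ) (s := Set.Ioi 0)
      fun t ht => ne_of_gt ht)
    have hiff : ∀ y ∈ U, (y ∈ Ω ↔ ρ y ≤ 0) := fun y hy => by
      have := Set.ext_iff.1 hΩ y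
      simpa [hy] using this
    constructor
    · intro hv
      filter_upwards [hU', hs'.eventually_lt_const hv, self_mem_nhdsWithin] with t ht hlt htpos
      rw [hiff _ ht]
      simp only [slope_def_field, zero_smul, add_zero, h0, sub_zero] at hlt
      by_contra hcon
      exact absurd hlt (not_lt.2 (div_nonneg (not_le.1 hcon).le (le_of_lt htpos)))
    · intro hv
      filter_upwards [hU', hs'.eventually_const_lt hv, self_mem_nhdsWithin] with t ht hlt htpos
      rw [hiff _ ht]
      simp only [slope_def_field, zero_smul, add_zero, h0, sub_zero] at hlt
      intro hcon
      exact absurd hlt (not_lt.2 (div_nonpos_of_nonpos_of_nonneg hcon (le_of_lt htpos)))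
  obtain ⟨ρ₁, hρ₁, rfl⟩ := h₁
  obtain ⟨ρ₂, hρ₂, rfl⟩ := h₂
  have k₁ := key ρ₁ hρ₁
  have k₂ := key ρ₂ hρ₂
  obtain ⟨-, -, -, -, -, hn₁, -⟩ := hρ₁
  obtain ⟨-, -, -, -, -, hn₂, -⟩ := hρ₂
  set g₁ := gradient ρ₁ x
  set g₂ := gradient ρ₂ x
  by_contra hne
  have p₁ : 0 < ‖g₁‖ := norm_pos_iff.2 hn₁
  have p₂ : 0 < ‖g₂‖ := norm_pos_iff.2 hn₂
  have hlt : inner ℝ g₁ g₂ < ‖g₁‖ * ‖g₂‖ := by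
    refine lt_of_le_of_ne (real_inner_le_norm _ _) fun h => hne ?_
    have := inner_eq_norm_mul_iff_real.1 h
    rw [inv_smul_eq_iff₀ p₁.ne', smul_comm, eq_inv_smul_iff₀ p₂.ne', this]
  have hv₁ : inner ℝ g₁ (‖g₁‖ • g₂ - ‖g₂‖ • g₁) < 0 := by
    rw [inner_sub_right, inner_smul_right, inner_smul_right, real_inner_self_eq_norm_sq]
    nlinarith
  have hv₂ : 0 < inner ℝ g₂ (‖g₁‖ • g₂ - ‖g₂‖ • g₁) := by
    rw [inner_sub_right, inner_smul_right, inner_smul_right, real_inner_self_eq_norm_sq,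
      real_inner_comm]
    nlinarith
  obtain ⟨t, h, h'⟩ := (((k₁ _).1 hv₁).and ((k₂ _).2 hv₂)).exists
  exact h' h

/-- A motion of the open region `M ⊆ ℝⁿ` with parameters in the open set `P ⊆ ℝᵐ`: a jointly `C²`
family of maps `φ C` on `M`, `C ∈ P`, each a diffeomorphism of `M` onto its image. -/
structure IsParametricMotion {m n : ℕ} (P : Set (EuclideanSpace ℝ (Fin m)))
    (M : Set (EuclideanSpace ℝ (Fin n)))
    (φ : EuclideanSpace ℝ (Fin m) → EuclideanSpace ℝ (Fin n) → EuclideanSpace ℝ (Fin n)) :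
    Prop where
  isOpen_params : IsOpen P
  isOpen_region : IsOpen M
  contDiffOn : ContDiffOn ℝ 2
    (fun q : EuclideanSpace ℝ (Fin m) × EuclideanSpace ℝ (Fin n) => φ q.1 q.2) (P ×ˢ M)
  injOn : ∀ C ∈ P, Set.InjOn (φ C) M
  isInvertible_fderiv : ∀ C ∈ P, ∀ s ∈ M, (fderiv ℝ (φ C) s).IsInvertible

/-- The `m × n` matrix field `∇_C X`, as a function of the parameter `C` and of the current position
`X`: its entry `(c, j)` is `∂X_j/∂C_c`, the derivative with respect to `C_c` of the `j`-th coordinate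
of the moving point `φ C s` that is at `X` when the parameter is `C` (`s` is held fixed). -/
noncomputable def parameterGradient {m n : ℕ} (M : Set (EuclideanSpace ℝ (Fin n)))
    (φ : EuclideanSpace ℝ (Fin m) → EuclideanSpace ℝ (Fin n) → EuclideanSpace ℝ (Fin n))
    (C : EuclideanSpace ℝ (Fin m)) (X : EuclideanSpace ℝ (Fin n)) : Matrix (Fin m) (Fin n) ℝ :=
  Matrix.of fun c j =>
    (fderiv ℝ (fun C' => φ C' (Function.invFunOn (φ C) M X)) C (EuclideanSpace.single c 1)) j

/-- The divergence `∇_X · T = [∇_Xᵀ T]ᵀ` of an `n × m` matrix field `T` on `ℝⁿ`: the vector in `ℝᵐ`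
whose `c`-th component is `∑ j, ∂T_{jc}/∂X_j`. -/
noncomputable def matrixDivergence {m n : ℕ}
    (T : EuclideanSpace ℝ (Fin n) → Matrix (Fin n) (Fin m) ℝ)
    (X : EuclideanSpace ℝ (Fin n)) : EuclideanSpace ℝ (Fin m) :=
  WithLp.toLp 2 fun c => ∑ j, fderiv ℝ (fun Y => T Y j c) X (EuclideanSpace.single j 1)

/-- The contraction `Tᵀ ν` (written `T · ν` in the `∂(→)/∂(↓)` convention) of an `n × m` matrix with
a vector of `ℝⁿ`: the vector in `ℝᵐ` with `c`-th component `∑ j, T_{jc} ν_j`. -/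
noncomputable def matrixDot {m n : ℕ} (T : Matrix (Fin n) (Fin m) ℝ)
    (ν : EuclideanSpace ℝ (Fin n)) : EuclideanSpace ℝ (Fin m) :=
  WithLp.toLp 2 fun c => ∑ j, T j c * ν j

/-!
The theorem combines the divergence theorem on compact `C¹` domains with differentiation under the
integral sign.

*The divergence theorem.* It is proved without an area formula for graphs. Near a boundary point
`x₀` with unit normal `e` take a direction `v` with `⟪e, v⟫ = 1`. In the oblique coordinates
`x₀ + y + t • v`, with `y` orthogonal to `e`, the domain is the part below a graph
(`exists_flat_graph`), and the graph can be made as flat as desired by shrinking the neighborhood,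
because `e` is the normal at `x₀`. The fundamental theorem of calculus on the lines in direction `v`
turns `∫ ∂_v f` over the domain into the integral of `f` over the hyperplane, and the projection of
the boundary along `v` onto the hyperplane is almost an isometry, so that it almost preserves the
Hausdorff measure. Hence `∫ ∂_v f` and `∫ f ⟪ν, v⟫` agree up to `ε ∫ |f|` for all `f` supported in a
neighborhood that depends on `ε` only (`exists_nhds_abs_integral_sub_le`). Every direction is a
combination of normalized ones. Summing over a partition of unity the errors add up to
`ε ∫ |f|` over the whole boundary, and `ε` is arbitrary
(`IsCompactC1Domain.integral_fderiv_eq_integral_frontier`).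

*The derivative of the integral.* Fix `C` and let `χ C' = φ C' ∘ (φ C)⁻¹` be the motion relative to
the configuration at `C`. The change of variables `X ↦ χ C' X` rewrites the integral over `Ω C'` as
the integral of `b (χ C' X) C' * |det D(χ C') X|` over the fixed domain `Ω C`, which is
differentiated under the integral sign (`ContDiffOn.hasFDerivAt_setIntegral`). As `χ C` is the
identity and the derivative of the determinant at the identity is the trace, the derivative of the
integrand is `∇_C b` plus the divergence of `b` times the velocity field
(`fderiv_mul_abs_det_fderiv_apply`). This gives the second form of the differential, and the
divergence theorem on `Ω C`, again a compact `C¹` domain, gives the first.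
-/

/-! ### Oblique coordinates and integration along lines -/

/-- Oblique coordinates `(t, y) ↦ x₀ + y + t • v` of `E` with base point `x₀`, along the hyperplane
orthogonal to `e` and the transversal direction `v`, normalized by `⟪e, v⟫ = 1`. -/
noncomputable def obliqueChart {E : Type*} [NormedAddCommGroup E] [InnerProductSpace ℝ E]
    (x₀ : E) {e v : E} (hv : inner ℝ e v = 1) : ℝ × (ℝ ∙ e)ᗮ ≃ₜ E where
  toFun p := x₀ + p.2 + p.1 • v
  invFun x := (inner ℝ e (x - x₀), ⟨(x - x₀) - (inner ℝ e (x - x₀) : ℝ) • v, by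
    rw [Submodule.mem_orthogonal_singleton_iff_inner_right, inner_sub_right, inner_smul_right, hv]
    simp⟩)
  left_inv p := by
    have h1 : inner ℝ e (p.2 : E) = 0 :=
      (Submodule.mem_orthogonal_singleton_iff_inner_right).1 p.2.2
    have h2 : x₀ + (p.2 : E) + p.1 • v - x₀ = p.2 + p.1 • v := by abel
    have h3 : inner ℝ e (x₀ + (p.2 : E) + p.1 • v - x₀) = p.1 := by
      rw [h2, inner_add_right, h1, inner_smul_right, hv]; simp
    refine Prod.ext h3 (Subtype.ext ?_)
    simp only [h3]
    rw [h2]; abel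
  right_inv x := by simp only; abel
  continuous_toFun := by fun_prop
  continuous_invFun := by fun_prop

theorem obliqueChart_apply {E : Type*} [NormedAddCommGroup E] [InnerProductSpace ℝ E]
    (x₀ : E) {e v : E} (hv : inner ℝ e v = 1) (p : ℝ × (ℝ ∙ e)ᗮ) :
    obliqueChart x₀ hv p = x₀ + p.2 + p.1 • v := rfl

/-- Shears along the second factor preserve the product measure. -/
theorem measurePreserving_shear {H : Type*} [NormedAddCommGroup H] [InnerProductSpace ℝ H]
    [FiniteDimensional ℝ H] [MeasurableSpace H] [BorelSpace H] (w : H) :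
    MeasurePreserving (fun p : ℝ × H => (p.1, p.2 + p.1 • w)) volume volume := by
  refine (MeasurePreserving.id (volume : Measure ℝ)).skew_product
    (g := fun t y => y + t • w) ?_ ?_
  · exact (by fun_prop : Continuous _).measurable
  · exact Filter.Eventually.of_forall fun t => map_add_right_eq_self _ _

theorem measurePreserving_measurableEquivProd_symm {E : Type*} [NormedAddCommGroup E]
    [InnerProductSpace ℝ E] [FiniteDimensional ℝ E] [MeasurableSpace E] [BorelSpace E]
    (K : Submodule ℝ E) (x₀ : E) :
    MeasurePreserving (K.measurableEquivProd x₀).symm volume volume := by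
  have h := (K.measurePreserving_measurableEquivProd x₀).symm
  rw [InnerProductSpace.euclideanHausdorffMeasure_eq_volume] at h
  exact h

theorem measurePreserving_obliqueChart {E : Type*} [NormedAddCommGroup E] [InnerProductSpace ℝ E]
    [FiniteDimensional ℝ E] [MeasurableSpace E] [BorelSpace E]
    (x₀ : E) {e v : E} (he : ‖e‖ = 1) (hv : inner ℝ e v = 1) :
    MeasurePreserving (obliqueChart x₀ hv) volume volume := by
  have hw : v - e ∈ (ℝ ∙ e)ᗮ := by
    rw [Submodule.mem_orthogonal_singleton_iff_inner_right, inner_sub_right, hv,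
      real_inner_self_eq_norm_sq, he]
    simp
  have h2 : MeasurePreserving (Prod.map (LinearIsometryEquiv.toSpanUnitSingleton (𝕜 := ℝ) e he)
      (id : (ℝ ∙ e)ᗮ → (ℝ ∙ e)ᗮ)) volume volume :=
    (LinearIsometryEquiv.measurePreserving _).prod (MeasurePreserving.id _)
  have heq : (obliqueChart x₀ hv : ℝ × (ℝ ∙ e)ᗮ → E) =
      fun p => ((ℝ ∙ e).measurableEquivProd x₀).symm
        (Prod.map (LinearIsometryEquiv.toSpanUnitSingleton (𝕜 := ℝ) e he)
          (id : (ℝ ∙ e)ᗮ → (ℝ ∙ e)ᗮ) (p.1, p.2 + p.1 • ⟨v - e, hw⟩)) := by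
    funext p
    rw [Submodule.measurableEquivProd_symm_apply]
    simp only [obliqueChart_apply, Prod.map,
      LinearIsometryEquiv.toSpanUnitSingleton_apply]
    simp only [vadd_eq_add, Submodule.coe_add, Submodule.coe_smul, id, smul_sub]
    abel
  rw [heq]
  exact (measurePreserving_measurableEquivProd_symm (ℝ ∙ e) x₀).comp
    (h2.comp (measurePreserving_shear (⟨v - e, hw⟩ : (ℝ ∙ e)ᗮ)))

/-- Two measures that dominate each other up to a factor `1 + ε` have nearly the same integrals. -/
theorem abs_integral_sub_integral_le_of_le_smul {α : Type*} [MeasurableSpace α] {μ ν : Measure α}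
    {ε : ℝ} (hε : 0 ≤ ε) (h₁ : μ ≤ ENNReal.ofReal (1 + ε) • ν)
    (h₂ : ν ≤ ENNReal.ofReal (1 + ε) • μ) {f : α → ℝ} (hf : Integrable f μ) :
    |∫ x, f x ∂ν - ∫ x, f x ∂μ| ≤ 2 * ε * ∫ x, |f x| ∂μ := by
  have hfν : Integrable f ν := Integrable.mono_measure (hf.smul_measure ENNReal.ofReal_ne_top) h₂
  -- Nonnegative functions first; the general case splits `f` into its two parts.
  have key : ∀ g : α → ℝ, (∀ x, 0 ≤ g x) → Integrable g μ → Integrable g ν →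
      |∫ x, g x ∂ν - ∫ x, g x ∂μ| ≤ 2 * ε * ∫ x, g x ∂μ := by
    intro g hg hμ hν
    have a1 : ∫ x, g x ∂ν ≤ (1 + ε) * ∫ x, g x ∂μ := by
      have := integral_mono_measure h₂ (Filter.Eventually.of_forall hg)
        (hμ.smul_measure ENNReal.ofReal_ne_top)
      rwa [integral_smul_measure, ENNReal.toReal_ofReal (by linarith), smul_eq_mul] at this
    have a2 : ∫ x, g x ∂μ ≤ (1 + ε) * ∫ x, g x ∂ν := by
      have := integral_mono_measure h₁ (Filter.Eventually.of_forall hg)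
        (hν.smul_measure ENNReal.ofReal_ne_top)
      rwa [integral_smul_measure, ENNReal.toReal_ofReal (by linarith), smul_eq_mul] at this
    have a3 : 0 ≤ ∫ x, g x ∂μ := integral_nonneg hg
    have a4 : 0 ≤ ∫ x, g x ∂ν := integral_nonneg hg
    rw [abs_le]
    constructor <;> nlinarith [mul_nonneg hε a3, mul_nonneg hε a4, mul_nonneg hε (mul_nonneg hε a3)]
  have k1 := key (fun x => max (f x) 0) (fun x => le_max_right _ _) hf.pos_part hfν.pos_part
  have k2 := key (fun x => max (-f x) 0) (fun x => le_max_right _ _) hf.neg_part hfν.neg_part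
  have e1 : ∀ κ : Measure α, Integrable f κ →
      ∫ x, f x ∂κ = ∫ x, max (f x) 0 ∂κ - ∫ x, max (-f x) 0 ∂κ := by
    intro κ hκ
    rw [← integral_sub hκ.pos_part hκ.neg_part]
    congr 1 with x
    rcases le_total 0 (f x) with h | h
    · rw [max_eq_left h, max_eq_right (by linarith)]; ring
    · rw [max_eq_right h, max_eq_left (by linarith)]; ring
  have e2 : ∫ x, |f x| ∂μ = ∫ x, max (f x) 0 ∂μ + ∫ x, max (-f x) 0 ∂μ := by
    rw [← integral_add hf.pos_part hf.neg_part]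
    congr 1 with x
    rcases le_total 0 (f x) with h | h
    · rw [max_eq_left h, max_eq_right (by linarith), abs_of_nonneg h]; ring
    · rw [max_eq_right h, max_eq_left (by linarith), abs_of_nonpos h]; ring
  rw [e1 ν hfν, e1 μ hf, e2]
  rw [abs_le] at *
  constructor <;> nlinarith

/-- The fundamental theorem of calculus on the lines in direction `v`, for the part of `Ω` below a
graph over the hyperplane orthogonal to `e`. -/
theorem integral_hasLineDerivAt_eq_integral_graph {E : Type*} [NormedAddCommGroup E]
    [InnerProductSpace ℝ E] [FiniteDimensional ℝ E] [MeasurableSpace E] [BorelSpace E]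
    (x₀ : E) {e v : E} (he : ‖e‖ = 1) (hv : inner ℝ e v = 1) {Ω : Set E} {a : ℝ}
    {B : Set (ℝ ∙ e)ᗮ} {γ : (ℝ ∙ e)ᗮ → ℝ} (hB : MeasurableSet B)
    (hγ : ∀ y ∈ B, γ y ∈ Set.Ioo (-a) a)
    (hlt : ∀ y ∈ B, ∀ t ∈ Set.Icc (-a) a, t < γ y → obliqueChart x₀ hv (t, y) ∈ interior Ω)
    (heq : ∀ y ∈ B, obliqueChart x₀ hv (γ y, y) ∈ frontier Ω)
    (hgt : ∀ y ∈ B, ∀ t ∈ Set.Icc (-a) a, γ y < t → obliqueChart x₀ hv (t, y) ∉ Ω)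
    (hΩ : IsClosed Ω) {f f' : E → ℝ} (hf : ContinuousOn f Ω)
    (hf' : ∀ x ∈ interior Ω, HasLineDerivAt ℝ f (f' x) x v) (hint : IntegrableOn f' (interior Ω))
    (hsupp : tsupport f ⊆ obliqueChart x₀ hv '' (Set.Ioo (-a) a ×ˢ B)) :
    ∫ x in interior Ω, f' x = ∫ y in B, f (obliqueChart x₀ hv (γ y, y)) := by
  set Φ := obliqueChart x₀ hv with hΦ
  have hmp := measurePreserving_obliqueChart x₀ he hv
  have hme : MeasurableEmbedding Φ := Φ.measurableEmbedding
  set g : E → ℝ := (interior Ω).indicator f' with hg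
  have hzero : ∀ t y, ¬ (t ∈ Set.Ioo (-a) a ∧ y ∈ B) → Φ (t, y) ∉ tsupport f := by
    intro t y h hmem
    obtain ⟨q, hq, hqe⟩ := hsupp hmem
    rw [Φ.injective hqe] at hq
    exact h hq
  -- Off the support of `f` the line derivative vanishes, so only the cylinder contributes.
  have hg0 : ∀ x, x ∉ tsupport f → g x = 0 := by
    intro x hx
    by_cases hxi : x ∈ interior Ω
    · rw [hg, Set.indicator_of_mem hxi]
      have h0 : HasLineDerivAt ℝ f (0 : ℝ) x v := by
        have h1 : f =ᶠ[𝓝 x] fun _ => (0 : ℝ) := notMem_tsupport_iff_eventuallyEq.1 hx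
        have h2 : HasFDerivAt f (0 : E →L[ℝ] ℝ) x :=
          (hasFDerivAt_const (0 : ℝ) x).congr_of_eventuallyEq h1
        simpa using h2.hasLineDerivAt v
      exact (hf' x hxi).unique h0
    · exact Set.indicator_of_notMem hxi _
  have hgint : Integrable g := (integrable_indicator_iff isOpen_interior.measurableSet).2 hint
  have hgΦ : Integrable (fun p => g (Φ p)) ((volume : Measure ℝ).prod volume) :=
    (hmp.integrable_comp_emb hme).2 hgint
  have e1 : ∫ x in interior Ω, f' x = ∫ p, g (Φ p) ∂((volume : Measure ℝ).prod volume) := by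
    rw [← integral_indicator isOpen_interior.measurableSet]
    exact (hmp.integral_comp hme g).symm
  rw [e1, integral_prod_symm _ hgΦ, ← integral_indicator hB]
  refine integral_congr_ae ?_
  filter_upwards [hgΦ.prod_left_ae] with y hy
  by_cases hyB : y ∈ B
  · rw [Set.indicator_of_mem hyB]
    have hind : (fun t => g (Φ (t, y))) =
        (Set.Ioo (-a) (γ y)).indicator (fun t => f' (Φ (t, y))) := by
      funext t
      by_cases ht : t ∈ Set.Ioo (-a) (γ y)
      · have : Φ (t, y) ∈ interior Ω := hlt y hyB t ⟨ht.1.le, (ht.2.trans (hγ y hyB).2).le⟩ ht.2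
        rw [Set.indicator_of_mem ht, hg, Set.indicator_of_mem this]
      · rw [Set.indicator_of_notMem ht]
        by_cases hta : t ∈ Set.Ioo (-a) a
        · have hγt : γ y ≤ t := by
            by_contra h
            exact ht ⟨hta.1, not_le.1 h⟩
          refine Set.indicator_of_notMem (fun hmem => ?_) _
          rcases hγt.eq_or_lt with h | h
          · have := heq y hyB
            rw [h] at this
            exact this.2 hmem
          · exact hgt y hyB t ⟨hta.1.le, hta.2.le⟩ h (interior_subset hmem)
        · exact hg0 _ (hzero t y fun h => hta h.1)
    have hle : -a ≤ γ y := (hγ y hyB).1.le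
    have hIoo : IntegrableOn (fun t => f' (Φ (t, y))) (Set.Ioo (-a) (γ y)) := by
      rw [hind] at hy
      exact (integrable_indicator_iff measurableSet_Ioo).1 hy
    rw [hind, integral_indicator measurableSet_Ioo, ← integral_Ioc_eq_integral_Ioo,
      ← intervalIntegral.integral_of_le hle]
    have hcont : ContinuousOn (fun t => f (Φ (t, y))) (Set.Icc (-a) (γ y)) := by
      refine hf.comp (Φ.continuous.comp (by fun_prop : Continuous fun t : ℝ => (t, y))).continuousOn
        fun t ht => ?_
      rcases ht.2.eq_or_lt with h | h
      · rw [h]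
        exact hΩ.frontier_subset (heq y hyB)
      · exact interior_subset (hlt y hyB t ⟨ht.1, ht.2.trans (hγ y hyB).2.le⟩ h)
    rw [intervalIntegral.integral_eq_sub_of_hasDerivAt_of_le (f := fun t => f (Φ (t, y))) hle hcont
      (fun t ht => ?_)]
    · have : f (Φ (-a, y)) = 0 := image_eq_zero_of_notMem_tsupport
        (hzero _ y fun h => lt_irrefl _ h.1.1)
      simp [this]
    · exact (intervalIntegrable_iff_integrableOn_Ioo_of_le hle).2 hIoo
    · have h1 := hf' (Φ (t, y))
        (hlt y hyB t ⟨ht.1.le, (ht.2.trans (hγ y hyB).2).le⟩ ht.2)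
      have h2 : HasDerivAt (fun s => f (Φ (t, y) + s • v)) (f' (Φ (t, y))) (t - t) := by
        rw [sub_self]; exact h1
      have h3 := h2.comp_sub_const t t
      refine h3.congr_of_eventuallyEq (Filter.Eventually.of_forall fun s => ?_)
      simp only [hΦ, obliqueChart_apply]
      congr 1
      module
  · rw [Set.indicator_of_notMem hyB]
    refine integral_eq_zero_of_ae (Filter.Eventually.of_forall fun t => ?_)
    exact hg0 _ (hzero t y fun h => hyB h.2)

/-! ### Flat graphs and Hausdorff measure -/

/-- Near a point where `ρ` vanishes with gradient a positive multiple of `e`, the set `{ρ ≤ 0}` lies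
below a graph over the hyperplane orthogonal to `e`, and the graph is as flat as desired. -/
theorem exists_flat_graph {E : Type*} [NormedAddCommGroup E] [InnerProductSpace ℝ E]
    (x₀ : E) {e v : E} (hv : inner ℝ e v = 1) {ρ : E → ℝ} {c : ℝ} (hc : 0 < c)
    (hρ : HasStrictFDerivAt ρ (c • innerSL ℝ e) x₀) (h0 : ρ x₀ = 0) {Ω V : Set E} (hV : IsOpen V)
    (hxV : x₀ ∈ V) (hcont : ContinuousOn ρ V) (hΩ : ∀ x ∈ V, x ∈ Ω ↔ ρ x ≤ 0) {η : ℝ} (hη : 0 < η) :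
    ∃ a > 0, ∃ r > 0, ∃ γ : (ℝ ∙ e)ᗮ → ℝ,
      (∀ y ∈ Metric.ball 0 r, ∀ t ∈ Set.Icc (-a) a, obliqueChart x₀ hv (t, y) ∈ V) ∧
      (∀ y ∈ Metric.ball 0 r, γ y ∈ Set.Ioo (-a) a) ∧
      (∀ y ∈ Metric.ball 0 r, ∀ t ∈ Set.Icc (-a) a, t < γ y →
        obliqueChart x₀ hv (t, y) ∈ interior Ω) ∧
      (∀ y ∈ Metric.ball 0 r, obliqueChart x₀ hv (γ y, y) ∈ frontier Ω) ∧
      (∀ y ∈ Metric.ball 0 r, ∀ t ∈ Set.Icc (-a) a, γ y < t → obliqueChart x₀ hv (t, y) ∉ Ω) ∧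
      (∀ y ∈ Metric.ball 0 r, ∀ y' ∈ Metric.ball 0 r, |γ y - γ y'| ≤ η * ‖y - y'‖) := by
  set Φ := obliqueChart x₀ hv with hΦ
  -- Strict differentiability with error `c * δ` gives both strict monotonicity of `ρ` in the
  -- direction `v` (as `δ * ‖v‖ < 1`) and the slope bound of the graph (as `2 * δ ≤ η`).
  obtain ⟨δ, hδ, hδη, hδv⟩ : ∃ δ : ℝ, 0 < δ ∧ 2 * δ ≤ η ∧ δ * ‖v‖ ≤ 1 / 2 := by
    refine ⟨min (η / 2) (1 / (2 * (‖v‖ + 1))), by positivity, ?_, ?_⟩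
    · linarith [min_le_left (η / 2) (1 / (2 * (‖v‖ + 1)))]
    · calc _ ≤ 1 / (2 * (‖v‖ + 1)) * ‖v‖ := by gcongr; exact min_le_right _ _
        _ ≤ 1 / 2 := by
          rw [div_mul_eq_mul_div, div_le_div_iff₀ (by positivity) (by positivity)]
          linarith
  obtain ⟨s, hs, happ⟩ := hρ.approximates_deriv_on_nhds (c := (c * δ).toNNReal)
    (Or.inr (Real.toNNReal_pos.2 (by positivity)))
  have happ' : ∀ p ∈ s, ∀ q ∈ s, |ρ p - ρ q - c * inner ℝ e (p - q)| ≤ c * δ * ‖p - q‖ := by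
    intro p hp q hq
    have := happ p hp q hq
    rw [Real.coe_toNNReal _ (by positivity)] at this
    simpa [Real.norm_eq_abs] using this
  have hΦ0 : Φ (0, 0) = x₀ := by simp [hΦ, obliqueChart_apply]
  have hsV : ∀ᶠ p : ℝ × (ℝ ∙ e)ᗮ in 𝓝 (0, 0), Φ p ∈ s ∩ V := by
    refine Φ.continuous.continuousAt.eventually_mem ?_
    rw [hΦ0]
    exact Filter.inter_mem hs (hV.mem_nhds hxV)
  obtain ⟨d, hd, hball⟩ := Metric.eventually_nhds_iff_ball.1 hsV
  obtain ⟨a, ha, had⟩ : ∃ a, 0 < a ∧ a < d := exists_between hd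
  have hmem : ∀ y ∈ Metric.ball (0 : (ℝ ∙ e)ᗮ) d, ∀ t ∈ Set.Icc (-a) a, Φ (t, y) ∈ s ∩ V := by
    intro y hy t ht
    apply hball
    rw [mem_ball_zero_iff] at hy
    rw [← Prod.zero_eq_mk, mem_ball_zero_iff, Prod.norm_def, max_lt_iff]
    exact ⟨(abs_le.2 ht).trans_lt had, hy⟩
  have hsub : ∀ t t' y, Φ (t, y) - Φ (t', y) = (t - t') • v := by
    intro t t' y
    simp only [hΦ, obliqueChart_apply]
    module
  have hmono : ∀ y ∈ Metric.ball (0 : (ℝ ∙ e)ᗮ) d, ∀ t ∈ Set.Icc (-a) a, ∀ t' ∈ Set.Icc (-a) a,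
      t' < t → ρ (Φ (t', y)) < ρ (Φ (t, y)) := by
    intro y hy t ht t' ht' hlt
    have h := happ' _ (hmem y hy t ht).1 _ (hmem y hy t' ht').1
    rw [hsub, inner_smul_right, hv, norm_smul, Real.norm_eq_abs, abs_of_pos (sub_pos.2 hlt)] at h
    have h1 := (abs_le.1 h).1
    have h2 : c * δ * ((t - t') * ‖v‖) ≤ c * (t - t') * (1 / 2) := by
      calc c * δ * ((t - t') * ‖v‖) = c * (t - t') * (δ * ‖v‖) := by ring
        _ ≤ _ := by
          have := sub_pos.2 hlt
          gcongr
    have h3 : 0 < c * (t - t') := mul_pos hc (sub_pos.2 hlt)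
    linarith
  have ha' : a ∈ Set.Icc (-a) a := ⟨by linarith, le_rfl⟩
  have hna' : -a ∈ Set.Icc (-a) a := ⟨le_rfl, by linarith⟩
  have h0' : (0 : ℝ) ∈ Set.Icc (-a) a := ⟨by linarith, ha.le⟩
  have hcontAt : ∀ x ∈ V, ContinuousAt ρ x := fun x hx => hcont.continuousAt (hV.mem_nhds hx)
  have hd0 := Metric.mem_ball_self (x := (0 : (ℝ ∙ e)ᗮ)) hd
  have hca : ∀ t ∈ Set.Icc (-a) a, ContinuousAt (fun y => ρ (Φ (t, y))) 0 := by
    intro t ht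
    have h1 : ContinuousAt (fun y => Φ (t, y)) (0 : (ℝ ∙ e)ᗮ) :=
      (Φ.continuous.comp (by fun_prop : Continuous fun y : (ℝ ∙ e)ᗮ => (t, y))).continuousAt
    exact ContinuousAt.comp (hcontAt _ (hmem 0 hd0 t ht).2) h1
  have hpos : ∀ᶠ y in 𝓝 (0 : (ℝ ∙ e)ᗮ), 0 < ρ (Φ (a, y)) := by
    refine (hca a ha').eventually_const_lt ?_
    have := hmono 0 hd0 a ha' 0 h0' ha
    rwa [hΦ0, h0] at this
  have hneg : ∀ᶠ y in 𝓝 (0 : (ℝ ∙ e)ᗮ), ρ (Φ (-a, y)) < 0 := by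
    refine (hca (-a) hna').eventually_lt_const ?_
    have := hmono 0 hd0 0 h0' (-a) hna' (by linarith)
    rwa [hΦ0, h0] at this
  obtain ⟨r, hr, hrball⟩ := Metric.eventually_nhds_iff_ball.1
    ((hpos.and hneg).and (Metric.ball_mem_nhds _ hd))
  have hzero : ∀ y, ∃ g : ℝ, y ∈ Metric.ball (0 : (ℝ ∙ e)ᗮ) r →
      g ∈ Set.Ioo (-a) a ∧ ρ (Φ (g, y)) = 0 := by
    intro y
    by_cases hy : y ∈ Metric.ball (0 : (ℝ ∙ e)ᗮ) r
    · have hc' : ContinuousOn (fun t => ρ (Φ (t, y))) (Set.Icc (-a) a) :=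
        hcont.comp (Φ.continuous.comp (by fun_prop : Continuous fun t : ℝ => (t, y))).continuousOn
          fun t ht => (hmem y (hrball y hy).2 t ht).2
      obtain ⟨g, hg, hg0⟩ := intermediate_value_Ioo (by linarith) hc'
        ⟨(hrball y hy).1.2, (hrball y hy).1.1⟩
      exact ⟨g, fun _ => ⟨hg, hg0⟩⟩
    · exact ⟨0, fun h => absurd h hy⟩
  choose γ hγ using hzero
  have hgt : ∀ y ∈ Metric.ball 0 r, ∀ t ∈ Set.Icc (-a) a, γ y < t → Φ (t, y) ∉ Ω := by
    intro y hy t ht hlt hmemΩ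
    have hyd := (hrball y hy).2
    have h1 := hmono y hyd t ht (γ y) (Set.Ioo_subset_Icc_self (hγ y hy).1) hlt
    rw [(hγ y hy).2] at h1
    exact absurd ((hΩ _ (hmem y hyd t ht).2).1 hmemΩ) (not_le.2 h1)
  refine ⟨a, ha, r, hr, γ, fun y hy t ht => (hmem y (hrball y hy).2 t ht).2,
    fun y hy => (hγ y hy).1, ?_, ?_, hgt, ?_⟩
  · intro y hy t ht hlt
    have hyd := (hrball y hy).2
    have h1 := hmono y hyd (γ y) (Set.Ioo_subset_Icc_self (hγ y hy).1) t ht hlt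
    rw [(hγ y hy).2] at h1
    have hxV := (hmem y hyd t ht).2
    rw [mem_interior_iff_mem_nhds]
    filter_upwards [(hcontAt _ hxV).eventually_lt_const h1, hV.mem_nhds hxV] with x hx hx'
    exact (hΩ x hx').2 hx.le
  · intro y hy
    have hyd := (hrball y hy).2
    obtain ⟨hγa, hγ0⟩ := hγ y hy
    have hxV := (hmem y hyd (γ y) (Set.Ioo_subset_Icc_self hγa)).2
    refine ⟨subset_closure ((hΩ _ hxV).2 hγ0.le), fun hint => ?_⟩
    have h1 : ∀ᶠ t in 𝓝 (γ y), Φ (t, y) ∈ Ω :=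
      (Φ.continuous.comp (by fun_prop : Continuous fun t : ℝ => (t, y))).continuousAt.eventually_mem
        (mem_interior_iff_mem_nhds.1 hint)
    obtain ⟨t, ht, ht'⟩ :=
      ((h1.filter_mono nhdsWithin_le_nhds).and (Ioo_mem_nhdsGT hγa.2)).exists
    exact hgt y hy t ⟨(hγa.1.trans ht'.1).le, ht'.2.le⟩ ht'.1 ht
  · intro y hy y' hy'
    have hp := hmem y (hrball y hy).2 (γ y) (Set.Ioo_subset_Icc_self (hγ y hy).1)
    have hp' := hmem y' (hrball y' hy').2 (γ y') (Set.Ioo_subset_Icc_self (hγ y' hy').1)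
    have h := happ' _ hp.1 _ hp'.1
    have hdiff : Φ (γ y, y) - Φ (γ y', y') = ((y - y' : (ℝ ∙ e)ᗮ) : E) + (γ y - γ y') • v := by
      simp only [hΦ, obliqueChart_apply, Submodule.coe_sub]
      module
    have hinner : inner ℝ e (Φ (γ y, y) - Φ (γ y', y')) = γ y - γ y' := by
      rw [hdiff, inner_add_right, inner_smul_right, hv,
        (Submodule.mem_orthogonal_singleton_iff_inner_right).1 (y - y').2]
      ring
    rw [(hγ y hy).2, (hγ y' hy').2, hinner, sub_self, zero_sub, abs_neg, abs_mul,
      abs_of_pos hc, mul_assoc] at h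
    have h1 : |γ y - γ y'| ≤ δ * ‖Φ (γ y, y) - Φ (γ y', y')‖ := le_of_mul_le_mul_left h hc
    have h2 : ‖Φ (γ y, y) - Φ (γ y', y')‖ ≤ ‖y - y'‖ + |γ y - γ y'| * ‖v‖ := by
      rw [hdiff]
      refine (norm_add_le _ _).trans ?_
      rw [norm_smul, Real.norm_eq_abs, Submodule.coe_norm]
    have h3 : δ * ‖Φ (γ y, y) - Φ (γ y', y')‖ ≤ δ * ‖y - y'‖ + |γ y - γ y'| * (1 / 2) := by
      calc _ ≤ δ * (‖y - y'‖ + |γ y - γ y'| * ‖v‖) := by gcongr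
        _ = δ * ‖y - y'‖ + |γ y - γ y'| * (δ * ‖v‖) := by ring
        _ ≤ _ := by gcongr
    calc |γ y - γ y'| ≤ 2 * δ * ‖y - y'‖ := by linarith
      _ ≤ η * ‖y - y'‖ := by gcongr

theorem LipschitzOnWith.euclideanHausdorffMeasure_image_le {X Y : Type*} [MetricSpace X]
    [MeasurableSpace X] [BorelSpace X] [MetricSpace Y] [MeasurableSpace Y] [BorelSpace Y]
    {K : NNReal} {f : X → Y} {s : Set X} (h : LipschitzOnWith K f s) (k : ℕ) :
    Measure.euclideanHausdorffMeasure k (f '' s) ≤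
      (K : ENNReal) ^ k * Measure.euclideanHausdorffMeasure k s := by
  have h1 := h.hausdorffMeasure_image_le (d := (k : ℝ)) (by positivity)
  rw [ENNReal.rpow_natCast] at h1
  rw [Measure.euclideanHausdorffMeasure_def, Measure.euclideanHausdorffMeasure_def,
    Measure.smul_apply, Measure.smul_apply, ENNReal.smul_def, smul_eq_mul, ENNReal.smul_def,
    smul_eq_mul, mul_left_comm]
  gcongr

/-- If `g` parametrizes `g '' B` with inverse `π`, both with Lipschitz constant `K`, then the
Hausdorff measure on `g '' B` is comparable to the one on `B` with factor `K ^ k`. -/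
theorem map_restrict_image_euclideanHausdorffMeasure {X Y : Type*} [MetricSpace X]
    [MeasurableSpace X] [BorelSpace X] [MetricSpace Y] [MeasurableSpace Y] [BorelSpace Y]
    {K : NNReal} {g : X → Y} {π : Y → X} {B : Set X} (hg : LipschitzOnWith K g B)
    (hπ : LipschitzOnWith K π (g '' B)) (hπm : Measurable π) (hinv : ∀ y ∈ B, π (g y) = y)
    (k : ℕ) :
    ((Measure.euclideanHausdorffMeasure k).restrict (g '' B)).map π ≤
      (K : ENNReal) ^ k • (Measure.euclideanHausdorffMeasure k).restrict B ∧
    (Measure.euclideanHausdorffMeasure k).restrict B ≤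
      (K : ENNReal) ^ k • ((Measure.euclideanHausdorffMeasure k).restrict (g '' B)).map π := by
  have himg : ∀ A : Set X, π ⁻¹' A ∩ g '' B = g '' (A ∩ B) := by
    intro A
    ext z
    constructor
    · rintro ⟨hz, y, hy, rfl⟩
      exact ⟨y, ⟨by simpa [hinv y hy] using hz, hy⟩, rfl⟩
    · rintro ⟨y, ⟨hyA, hy⟩, rfl⟩
      exact ⟨by simpa [hinv y hy] using hyA, y, hy, rfl⟩
  have himg' : ∀ A : Set X, π '' (g '' (A ∩ B)) = A ∩ B := by
    intro A
    rw [Set.image_image]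
    exact (Set.image_congr fun y hy => hinv y hy.2).trans (Set.image_id' _)
  constructor
  · refine Measure.le_iff.2 fun A hA => ?_
    rw [Measure.map_apply hπm hA, Measure.restrict_apply (hπm hA), himg, Measure.smul_apply,
      Measure.restrict_apply hA, smul_eq_mul]
    exact (hg.mono Set.inter_subset_right).euclideanHausdorffMeasure_image_le k
  · refine Measure.le_iff.2 fun A hA => ?_
    rw [Measure.smul_apply, Measure.map_apply hπm hA, Measure.restrict_apply (hπm hA), himg,
      Measure.restrict_apply hA, smul_eq_mul]
    have h := (hπ.mono (Set.image_mono (Set.inter_subset_right (s := A)))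
      ).euclideanHausdorffMeasure_image_le k
    rwa [himg'] at h

/-! ### The divergence theorem near a flat piece of boundary -/

theorem exists_one_lt_pow_le (k : ℕ) {ε : ℝ} (hε : 0 < ε) :
    ∃ K : NNReal, 1 < K ∧ (K : ℝ) ^ k ≤ 1 + ε := by
  have h1 : Filter.Tendsto (fun K : NNReal => (K : ℝ) ^ k) (𝓝[>] 1) (𝓝 ((1 : NNReal) : ℝ)) := by
    have : Continuous fun K : NNReal => (K : ℝ) ^ k := by fun_prop
    have h := this.tendsto 1
    simp only [NNReal.coe_one, one_pow] at h
    exact h.mono_left nhdsWithin_le_nhds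
  have h2 := h1.eventually_le_const (u := 1 + ε) (by simpa using hε)
  obtain ⟨K, hK, hK1⟩ := (h2.and self_mem_nhdsWithin).exists
  exact ⟨K, hK1, hK⟩

/-- The local form of the divergence theorem in a direction `v` that is normalized against the
normal at `x₀`, up to a relative error `ε`: near `x₀` the boundary is so flat that its Hausdorff
measure nearly is the Lebesgue measure of its projection along `v`. -/
theorem exists_nhds_abs_integral_sub_le {E : Type*} [NormedAddCommGroup E]
    [InnerProductSpace ℝ E] [FiniteDimensional ℝ E] [MeasurableSpace E] [BorelSpace E] {k : ℕ}
    (hk : Module.finrank ℝ E = k + 1)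
    (x₀ : E) {e v : E} (he : ‖e‖ = 1) (hv : inner ℝ e v = 1) {ρ : E → ℝ} {c : ℝ} (hc : 0 < c)
    (hρ : HasStrictFDerivAt ρ (c • innerSL ℝ e) x₀) (h0 : ρ x₀ = 0) {Ω V : Set E} (hV : IsOpen V)
    (hxV : x₀ ∈ V) (hcont : ContinuousOn ρ V) (hΩ : ∀ x ∈ V, x ∈ Ω ↔ ρ x ≤ 0)
    (hcpt : IsCompact Ω) {ν : E → E} (hν : ContinuousOn ν (frontier Ω)) (hxΩ : x₀ ∈ frontier Ω)
    (hν0 : ν x₀ = e) {ε : ℝ} (hε : 0 < ε) :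
    ∃ U : Set E, IsOpen U ∧ x₀ ∈ U ∧
      Measure.euclideanHausdorffMeasure k (frontier Ω ∩ U) < ⊤ ∧
      ∀ f f' : E → ℝ, ContinuousOn f Ω → (∀ x ∈ interior Ω, HasLineDerivAt ℝ f (f' x) x v) →
        IntegrableOn f' (interior Ω) → tsupport f ⊆ U →
        |(∫ x in interior Ω, f' x) -
          ∫ x in frontier Ω, f x * inner ℝ (ν x) v ∂(Measure.euclideanHausdorffMeasure k)| ≤
        ε * ∫ x in frontier Ω, |f x| ∂(Measure.euclideanHausdorffMeasure k) := by
  -- Two thirds of the error come from the comparison of measures, one third from the variation of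
  -- the normal.
  set ε' := ε / 3 with hε'
  have hε'0 : 0 < ε' := by positivity
  have hvol : (Measure.euclideanHausdorffMeasure k : Measure (ℝ ∙ e)ᗮ) = volume := by
    have : Fact (Module.finrank ℝ E = k + 1) := ⟨hk⟩
    have he0 : e ≠ 0 := by
      rintro rfl
      simp at he
    rw [← Submodule.finrank_orthogonal_span_singleton (𝕜 := ℝ) (n := k) he0]
    exact InnerProductSpace.euclideanHausdorffMeasure_eq_volume
  -- On a neighbourhood `W` of `x₀` the normal is nearly constant along the boundary.
  obtain ⟨W, hW, hxW, hWν⟩ : ∃ W, IsOpen W ∧ x₀ ∈ W ∧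
      ∀ x ∈ frontier Ω ∩ W, |inner ℝ (ν x) v - 1| ≤ ε' := by
    have h1 : ContinuousWithinAt (fun x => |inner ℝ (ν x) v - 1|) (frontier Ω) x₀ :=
      (((hν x₀ hxΩ).inner continuousWithinAt_const).sub continuousWithinAt_const).abs
    have h2 : ∀ᶠ x in 𝓝[frontier Ω] x₀, |inner ℝ (ν x) v - 1| < ε' := by
      refine h1.eventually_lt_const ?_
      simp [hν0, hv, hε'0]
    obtain ⟨W, hW, hxW, hWsub⟩ := mem_nhdsWithin.1 h2
    exact ⟨W, hW, hxW, fun x hx => le_of_lt (hWsub ⟨hx.2, hx.1⟩)⟩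
  obtain ⟨K, hK1, hKk⟩ := exists_one_lt_pow_le k hε'0
  have hK1' : (1 : ℝ) < K := by exact_mod_cast hK1
  -- Slope `η` of the graph for which the parametrization and its inverse are `K`-Lipschitz.
  set η := (K - 1 : ℝ) / K / (‖v‖ + 1) with hη
  have hη0 : 0 < η := by
    have := sub_pos.2 hK1'
    positivity
  have hηv : η * ‖v‖ ≤ (K - 1 : ℝ) / K := by
    rw [hη, div_mul_eq_mul_div, div_le_iff₀ (by positivity)]
    have : 0 ≤ (K - 1 : ℝ) / K := div_nonneg (by linarith) (by linarith)
    nlinarith [norm_nonneg v]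
  obtain ⟨a, ha, r, hr, γ, hcyl, hγ, hlt, heq, hgt, hlip⟩ := exists_flat_graph x₀ hv hc hρ h0
    (hV.inter hW) ⟨hxV, hxW⟩ (hcont.mono Set.inter_subset_left) (fun x hx => hΩ x hx.1) hη0
  set Φ := obliqueChart x₀ hv with hΦ
  set B := Metric.ball (0 : (ℝ ∙ e)ᗮ) r with hB
  set G : (ℝ ∙ e)ᗮ → E := fun y => Φ (γ y, y) with hG
  set π : E → (ℝ ∙ e)ᗮ := fun x => (Φ.symm x).2 with hπ
  have hπc : Continuous π := continuous_snd.comp Φ.symm.continuous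
  have hinv : ∀ y ∈ B, π (G y) = y := fun y _ => by simp [hπ, hG]
  have hdiff : ∀ y y', G y - G y' = ((y - y' : (ℝ ∙ e)ᗮ) : E) + (γ y - γ y') • v := by
    intro y y'
    simp only [hG, hΦ, obliqueChart_apply, Submodule.coe_sub]
    module
  have hK0 : (0 : ℝ) < K := by linarith
  have hsmall : ∀ y ∈ B, ∀ y' ∈ B, ‖(γ y - γ y') • v‖ ≤ (K - 1 : ℝ) / K * ‖y - y'‖ := by
    intro y hy y' hy'
    rw [norm_smul, Real.norm_eq_abs]
    calc _ ≤ η * ‖y - y'‖ * ‖v‖ := by gcongr; exact hlip y hy y' hy'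
      _ = η * ‖v‖ * ‖y - y'‖ := by ring
      _ ≤ _ := by gcongr
  have hGlip : LipschitzOnWith K G B := by
    refine LipschitzOnWith.of_dist_le_mul fun y hy y' hy' => ?_
    rw [dist_eq_norm, dist_eq_norm, hdiff]
    refine (norm_add_le _ _).trans ?_
    rw [← Submodule.coe_norm]
    have h1 := hsmall y hy y' hy'
    have h2 : 1 + (K - 1 : ℝ) / K ≤ K := by
      have h3 : (K - 1 : ℝ) / K ≤ K - 1 := div_le_self (by linarith) hK1'.le
      linarith
    nlinarith [norm_nonneg (y - y')]
  have hπlip : LipschitzOnWith K π (G '' B) := by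
    refine LipschitzOnWith.of_dist_le_mul ?_
    rintro _ ⟨y, hy, rfl⟩ _ ⟨y', hy', rfl⟩
    rw [hinv y hy, hinv y' hy', dist_eq_norm, dist_eq_norm]
    have h1 := hsmall y hy y' hy'
    have h2 : ‖y - y'‖ ≤ ‖G y - G y'‖ + ‖(γ y - γ y') • v‖ := by
      have : ((y - y' : (ℝ ∙ e)ᗮ) : E) = (G y - G y') - (γ y - γ y') • v := by rw [hdiff]; abel
      rw [Submodule.coe_norm, this]
      exact norm_sub_le _ _
    have h3 : (K - 1 : ℝ) / K = 1 - 1 / K := by field_simp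
    rw [h3] at h1
    have h4 : 1 / K * ‖y - y'‖ ≤ ‖G y - G y'‖ := by linarith
    rw [div_mul_eq_mul_div, one_mul, div_le_iff₀ hK0] at h4
    linarith
  obtain ⟨hm1, hm2⟩ :=
    map_restrict_image_euclideanHausdorffMeasure hGlip hπlip hπc.measurable hinv k
  rw [hvol] at hm1 hm2
  set κ : Measure E := Measure.euclideanHausdorffMeasure k with hκ
  set U : Set E := Φ '' (Set.Ioo (-a) a ×ˢ B) with hU
  have hUo : IsOpen U := Φ.isOpenMap _ (isOpen_Ioo.prod Metric.isOpen_ball)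
  have hSU : frontier Ω ∩ U = G '' B := by
    ext x
    constructor
    · rintro ⟨hx, ⟨t, y⟩, ⟨ht, hy⟩, rfl⟩
      have ht' := Set.Ioo_subset_Icc_self ht
      refine ⟨y, hy, ?_⟩
      rcases lt_trichotomy t (γ y) with h | h | h
      · exact absurd (hlt y hy t ht' h) hx.2
      · rw [h]
      · exact absurd (hcpt.isClosed.frontier_subset hx) (hgt y hy t ht' h)
    · rintro ⟨y, hy, rfl⟩
      exact ⟨heq y hy, _, ⟨hγ y hy, hy⟩, rfl⟩
  have hUW : U ⊆ W := by
    rintro _ ⟨⟨t, y⟩, ⟨ht, hy⟩, rfl⟩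
    exact (hcyl y hy t (Set.Ioo_subset_Icc_self ht)).2
  have hSmeas : MeasurableSet (G '' B) := by
    rw [← hSU]
    exact isClosed_frontier.measurableSet.inter hUo.measurableSet
  have hfin : κ (frontier Ω ∩ U) < ⊤ := by
    rw [hSU]
    refine (hGlip.euclideanHausdorffMeasure_image_le k).trans_lt ?_
    rw [hvol]
    exact ENNReal.mul_lt_top (ENNReal.pow_lt_top ENNReal.coe_lt_top) measure_ball_lt_top
  refine ⟨U, hUo, ?_, hfin, ?_⟩
  · refine ⟨(0, 0), ⟨⟨by simpa using ha, ha⟩, Metric.mem_ball_self hr⟩, ?_⟩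
    simp [hΦ, obliqueChart_apply]
  intro f f' hf hf' hint hsupp
  have hf0 : ∀ x ∈ frontier Ω \ (G '' B), f x = 0 := by
    intro x hx
    refine image_eq_zero_of_notMem_tsupport fun hxs => hx.2 ?_
    rw [← hSU]
    exact ⟨hx.1, hsupp hxs⟩
  have hsub : G '' B ⊆ frontier Ω := by
    rw [← hSU]; exact Set.inter_subset_left
  have hsubΩ : G '' B ⊆ Ω := hsub.trans hcpt.isClosed.frontier_subset
  have e1 : ∫ x in frontier Ω, f x * inner ℝ (ν x) v ∂κ = ∫ x in G '' B, f x * inner ℝ (ν x) v ∂κ :=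
    setIntegral_eq_of_subset_of_forall_sdiff_eq_zero isClosed_frontier.measurableSet hsub
      fun x hx => by rw [hf0 x hx, zero_mul]
  have e2 : ∫ x in frontier Ω, |f x| ∂κ = ∫ x in G '' B, |f x| ∂κ :=
    setIntegral_eq_of_subset_of_forall_sdiff_eq_zero isClosed_frontier.measurableSet hsub
      fun x hx => by rw [hf0 x hx, abs_zero]
  have e3 := integral_hasLineDerivAt_eq_integral_graph x₀ he hv Metric.isOpen_ball.measurableSet hγ
    hlt heq hgt hcpt.isClosed hf hf' hint hsupp
  rw [e1, e2, e3]
  have : IsFiniteMeasure (κ.restrict (G '' B)) := ⟨by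
    rw [Measure.restrict_apply_univ, ← hSU]; exact hfin⟩
  obtain ⟨Cb, hCb⟩ := hcpt.exists_bound_of_continuousOn hf
  have hfint : Integrable f (κ.restrict (G '' B)) :=
    Integrable.of_bound ((hf.mono hsubΩ).aestronglyMeasurable hSmeas) Cb
      ((ae_restrict_iff' hSmeas).2 (Filter.Eventually.of_forall fun x hx => hCb x (hsubΩ hx)))
  have hGc : ContinuousOn (f ∘ G) B :=
    hf.comp hGlip.continuousOn fun y hy => hsubΩ ⟨y, hy, rfl⟩
  set lam : Measure (ℝ ∙ e)ᗮ := volume.restrict B with hlam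
  set m : Measure (ℝ ∙ e)ᗮ := (κ.restrict (G '' B)).map π with hm
  have hpow : (K : ENNReal) ^ k ≤ ENNReal.ofReal (1 + ε') := by
    rw [← ENNReal.ofReal_coe_nnreal, ← ENNReal.ofReal_pow hK0.le]
    exact ENNReal.ofReal_le_ofReal hKk
  -- The surface measure, projected along `v`, is comparable to the Lebesgue measure on `B`.
  have hm1' : m ≤ ENNReal.ofReal (1 + ε') • lam :=
    hm1.trans (Measure.le_iff.2 fun A _ => by
      simp only [Measure.smul_apply, smul_eq_mul]; gcongr)
  have hm2' : lam ≤ ENNReal.ofReal (1 + ε') • m :=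
    hm2.trans (Measure.le_iff.2 fun A _ => by
      simp only [Measure.smul_apply, smul_eq_mul]; gcongr)
  have hac : m ≪ lam :=
    (Measure.absolutelyContinuous_of_le hm1').trans Measure.smul_absolutelyContinuous
  have hGm : AEStronglyMeasurable (f ∘ G) m :=
    (hGc.aestronglyMeasurable Metric.isOpen_ball.measurableSet).mono_ac hac
  have hpull : ∀ x ∈ G '' B, (f ∘ G) (π x) = f x := by
    rintro _ ⟨y, hy, rfl⟩
    simp only [Function.comp, hinv y hy]
  have hpull' : (fun x => (f ∘ G) (π x)) =ᵐ[κ.restrict (G '' B)] f :=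
    (ae_restrict_iff' hSmeas).2 (Filter.Eventually.of_forall hpull)
  have e4 : ∫ y, (f ∘ G) y ∂m = ∫ x in G '' B, f x ∂κ := by
    rw [hm, integral_map hπc.aemeasurable hGm]
    exact integral_congr_ae hpull'
  have e5 : ∫ y, |(f ∘ G) y| ∂m = ∫ x in G '' B, |f x| ∂κ := by
    simp_rw [← Real.norm_eq_abs]
    rw [hm, integral_map hπc.aemeasurable hGm.norm]
    exact integral_congr_ae (hpull'.mono fun x hx => congrArg norm hx)
  have hGint : Integrable (f ∘ G) m := by
    rw [hm, integrable_map_measure hGm hπc.aemeasurable]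
    exact hfint.congr hpull'.symm
  have k1 := abs_integral_sub_integral_le_of_le_smul hε'0.le hm1' hm2' hGint
  rw [e4, e5] at k1
  have hνm : ContinuousOn (fun x => f x * inner ℝ (ν x) v) (G '' B) :=
    (hf.mono hsubΩ).mul ((hν.mono hsub).inner continuousOn_const)
  -- Replacing the constant `1 = ⟪e, v⟫` by `⟪ν x, v⟫` costs another relative error `ε'`.
  have hbd : ∀ x ∈ G '' B, ‖f x - f x * inner ℝ (ν x) v‖ ≤ ε' * |f x| := by
    intro x hx
    have h1 := hWν x ⟨hsub hx, hUW (by rw [← hSU] at hx; exact hx.2)⟩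
    rw [Real.norm_eq_abs, show f x - f x * inner ℝ (ν x) v = -((inner ℝ (ν x) v - 1) * f x) by ring,
      abs_neg, abs_mul]
    gcongr
  have hbd' := (ae_restrict_iff' (μ := κ) hSmeas).2 (Filter.Eventually.of_forall hbd)
  have hdint : Integrable (fun x => f x - f x * inner ℝ (ν x) v) (κ.restrict (G '' B)) :=
    Integrable.mono' (hfint.abs.const_mul ε')
      (((hf.mono hsubΩ).sub hνm).aestronglyMeasurable hSmeas) hbd'
  have hνint : Integrable (fun x => f x * inner ℝ (ν x) v) (κ.restrict (G '' B)) := by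
    have := hfint.sub hdint
    refine this.congr (Filter.Eventually.of_forall fun x => ?_)
    simp
  have k2 : |∫ x in G '' B, f x ∂κ - ∫ x in G '' B, f x * inner ℝ (ν x) v ∂κ| ≤
      ε' * ∫ x in G '' B, |f x| ∂κ := by
    rw [← integral_sub hfint hνint, ← integral_const_mul, ← Real.norm_eq_abs]
    exact norm_integral_le_of_norm_le (hfint.abs.const_mul ε') hbd'
  have k3 : ∫ y in B, f (Φ (γ y, y)) = ∫ y, (f ∘ G) y ∂lam := rfl
  rw [k3]
  calc _ ≤ |∫ y, (f ∘ G) y ∂lam - ∫ x in G '' B, f x ∂κ| +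
        |∫ x in G '' B, f x ∂κ - ∫ x in G '' B, f x * inner ℝ (ν x) v ∂κ| := abs_sub_le _ _ _
    _ ≤ 2 * ε' * ∫ x in G '' B, |f x| ∂κ + ε' * ∫ x in G '' B, |f x| ∂κ := add_le_add k1 k2
    _ = ε * ∫ x in G '' B, |f x| ∂κ := by rw [hε']; ring

/-! ### Compact domains of class C¹: normal, boundary measure, local estimates -/

theorem IsLocalDefiningFunction.continuousAt_gradient {n : ℕ} {Ω : Set (EuclideanSpace ℝ (Fin n))}
    {x : EuclideanSpace ℝ (Fin n)} {ρ : EuclideanSpace ℝ (Fin n) → ℝ}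
    (h : IsLocalDefiningFunction Ω x ρ) : ContinuousAt (gradient ρ) x := by
  obtain ⟨U, hU, hxU, hρ, -, -, -⟩ := h
  exact (InnerProductSpace.toDual ℝ _).symm.continuous.continuousAt.comp
    ((hρ.continuousOn_fderiv_of_isOpen hU le_rfl).continuousAt (hU.mem_nhds hxU))

/-- A local defining function at a point is one at all nearby boundary points. -/
theorem IsLocalDefiningFunction.eventually {n : ℕ} {Ω : Set (EuclideanSpace ℝ (Fin n))}
    {x : EuclideanSpace ℝ (Fin n)} {ρ : EuclideanSpace ℝ (Fin n) → ℝ}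
    (h : IsLocalDefiningFunction Ω x ρ) (hΩ : IsClosed Ω) :
    ∀ᶠ y in 𝓝[frontier Ω] x, IsLocalDefiningFunction Ω y ρ := by
  have hg := h.continuousAt_gradient
  obtain ⟨U, hU, hxU, hρ, h0, hne, heq⟩ := h
  filter_upwards [self_mem_nhdsWithin, nhdsWithin_le_nhds (hU.mem_nhds hxU),
    nhdsWithin_le_nhds (hg.eventually_ne hne)] with y hy hyU hyg
  have hiff : ∀ z ∈ U, (z ∈ Ω ↔ ρ z ≤ 0) := fun z hz => by
    have := Set.ext_iff.1 heq z
    simpa [hz] using this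
  refine ⟨U, hU, hyU, hρ, ?_, hyg, heq⟩
  refine le_antisymm ((hiff y hyU).1 (hΩ.frontier_subset hy)) (not_lt.1 fun hlt => hy.2 ?_)
  rw [mem_interior_iff_mem_nhds]
  filter_upwards [(hρ.continuousOn.continuousAt (hU.mem_nhds hyU)).eventually_lt_const hlt,
    hU.mem_nhds hyU] with z hz hzU
  exact (hiff z hzU).2 hz.le

theorem IsLocalDefiningFunction.outwardUnitNormal_eq {n : ℕ}
    {Ω : Set (EuclideanSpace ℝ (Fin n))} {x : EuclideanSpace ℝ (Fin n)}
    {ρ : EuclideanSpace ℝ (Fin n) → ℝ} (h : IsLocalDefiningFunction Ω x ρ) :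
    outwardUnitNormal Ω x = ‖gradient ρ x‖⁻¹ • gradient ρ x := by
  have hex : ∃ ν, IsOutwardUnitNormal Ω x ν := ⟨_, ρ, h, rfl⟩
  rw [outwardUnitNormal, dif_pos hex]
  exact hex.choose_spec.unique ⟨ρ, h, rfl⟩

theorem IsCompactC1Domain.continuousOn_outwardUnitNormal {n : ℕ}
    {Ω : Set (EuclideanSpace ℝ (Fin n))} (hΩ : IsCompactC1Domain Ω) :
    ContinuousOn (outwardUnitNormal Ω) (frontier Ω) := by
  intro x hx
  obtain ⟨ρ, hρ⟩ := hΩ.boundary x hx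
  have h1 : ContinuousAt (fun y => ‖gradient ρ y‖⁻¹ • gradient ρ y) x := by
    have hg := hρ.continuousAt_gradient
    obtain ⟨-, -, -, -, -, hne, -⟩ := hρ
    exact (hg.norm.inv₀ (norm_ne_zero_iff.2 hne)).smul hg
  refine h1.continuousWithinAt.congr_of_eventuallyEq ?_ hρ.outwardUnitNormal_eq
  filter_upwards [hρ.eventually hΩ.isCompact.isClosed] with y hy
  exact hy.outwardUnitNormal_eq

/-- At a boundary point, the local divergence theorem holds up to any relative error, in each
direction that is normalized against the normal. -/
theorem IsCompactC1Domain.exists_nhds_abs_integral_sub_le_of_inner_eq_one {k : ℕ}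
    {Ω : Set (EuclideanSpace ℝ (Fin (k + 1)))} (hΩ : IsCompactC1Domain Ω)
    {x : EuclideanSpace ℝ (Fin (k + 1))} (hx : x ∈ frontier Ω)
    {v : EuclideanSpace ℝ (Fin (k + 1))} (hv : inner ℝ (outwardUnitNormal Ω x) v = 1)
    {ε : ℝ} (hε : 0 < ε) :
    ∃ U : Set (EuclideanSpace ℝ (Fin (k + 1))), IsOpen U ∧ x ∈ U ∧
      Measure.euclideanHausdorffMeasure k (frontier Ω ∩ U) < ⊤ ∧
      ∀ f f' : EuclideanSpace ℝ (Fin (k + 1)) → ℝ, ContinuousOn f Ω →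
        (∀ x ∈ interior Ω, HasLineDerivAt ℝ f (f' x) x v) →
        IntegrableOn f' (interior Ω) → tsupport f ⊆ U →
        |(∫ x in interior Ω, f' x) - ∫ x in frontier Ω, f x * inner ℝ (outwardUnitNormal Ω x) v
            ∂(Measure.euclideanHausdorffMeasure k)| ≤
        ε * ∫ x in frontier Ω, |f x| ∂(Measure.euclideanHausdorffMeasure k) := by
  obtain ⟨ρ, hρ⟩ := hΩ.boundary x hx
  have hν := hρ.outwardUnitNormal_eq
  obtain ⟨V, hV, hxV, hρV, h0, hne, heq⟩ := hρ
  have hpos : 0 < ‖gradient ρ x‖ := norm_pos_iff.2 hne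
  have hgr : gradient ρ x = ‖gradient ρ x‖ • outwardUnitNormal Ω x := by
    rw [hν, smul_inv_smul₀ hpos.ne']
  have hnorm : ‖outwardUnitNormal Ω x‖ = 1 := by
    rw [hν, norm_smul, norm_inv, norm_norm, inv_mul_cancel₀ hpos.ne']
  have hcd : ContDiffAt ℝ 1 ρ x := hρV.contDiffAt (hV.mem_nhds hxV)
  have hstrict : HasStrictFDerivAt ρ
      (‖gradient ρ x‖ • innerSL ℝ (outwardUnitNormal Ω x)) x := by
    have h1 := hcd.hasStrictFDerivAt (by simp)
    have h2 : fderiv ℝ ρ x = innerSL ℝ (gradient ρ x) := by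
      have h3 : HasGradientAt ρ (gradient ρ x) x :=
        (hcd.differentiableAt (by simp)).hasGradientAt
      exact h3.hasFDerivAt.fderiv
    rw [h2, hgr, map_smul] at h1
    exact h1
  have hiff : ∀ z ∈ V, (z ∈ Ω ↔ ρ z ≤ 0) := fun z hz => by
    have := Set.ext_iff.1 heq z
    simpa [hz] using this
  exact exists_nhds_abs_integral_sub_le (by simp) x hnorm hv hpos hstrict h0 hV hxV
    hρV.continuousOn hiff hΩ.isCompact hΩ.continuousOn_outwardUnitNormal hx rfl hε

theorem IsCompactC1Domain.norm_outwardUnitNormal {n : ℕ}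
    {Ω : Set (EuclideanSpace ℝ (Fin n))} (hΩ : IsCompactC1Domain Ω)
    {x : EuclideanSpace ℝ (Fin n)} (hx : x ∈ frontier Ω) : ‖outwardUnitNormal Ω x‖ = 1 := by
  obtain ⟨ρ, hρ⟩ := hΩ.boundary x hx
  have hν := hρ.outwardUnitNormal_eq
  obtain ⟨-, -, -, -, -, hne, -⟩ := hρ
  rw [hν, norm_smul, norm_inv, norm_norm, inv_mul_cancel₀ (norm_ne_zero_iff.2 hne)]

theorem IsCompactC1Domain.isCompact_frontier {n : ℕ}
    {Ω : Set (EuclideanSpace ℝ (Fin n))} (hΩ : IsCompactC1Domain Ω) : IsCompact (frontier Ω) :=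
  hΩ.isCompact.of_isClosed_subset isClosed_frontier hΩ.isCompact.isClosed.frontier_subset

/-- The boundary of a compact `C¹` domain has finite surface measure. -/
theorem IsCompactC1Domain.euclideanHausdorffMeasure_frontier_lt_top {n : ℕ}
    {Ω : Set (EuclideanSpace ℝ (Fin n))} (hΩ : IsCompactC1Domain Ω) :
    Measure.euclideanHausdorffMeasure (n - 1) (frontier Ω) < ⊤ := by
  cases n with
  | zero => simp
  | succ k =>
    have hloc : ∀ x ∈ frontier Ω, ∃ t ∈ 𝓝[frontier Ω] x,
        Measure.euclideanHausdorffMeasure k t < ⊤ := by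
      intro x hx
      obtain ⟨U, hU, hxU, hfin, -⟩ := hΩ.exists_nhds_abs_integral_sub_le_of_inner_eq_one hx
        (v := outwardUnitNormal Ω x)
        (by rw [real_inner_self_eq_norm_sq, hΩ.norm_outwardUnitNormal hx]; norm_num) one_pos
      exact ⟨frontier Ω ∩ U, inter_mem_nhdsWithin _ (hU.mem_nhds hxU), hfin⟩
    exact hΩ.isCompact_frontier.measure_lt_top_of_nhdsWithin hloc

theorem IsCompactC1Domain.volume_frontier {n : ℕ}
    {Ω : Set (EuclideanSpace ℝ (Fin n))} (hΩ : IsCompactC1Domain Ω) :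
    volume (frontier Ω) = 0 := by
  cases n with
  | zero => simp
  | succ k =>
    rw [← EuclideanSpace.euclideanHausdorffMeasure_eq_volume]
    exact (Measure.euclideanHausdorffMeasure_zero_or_top k.lt_succ_self _).resolve_right
      hΩ.euclideanHausdorffMeasure_frontier_lt_top.ne

theorem IsCompactC1Domain.interior_ae_eq {n : ℕ}
    {Ω : Set (EuclideanSpace ℝ (Fin n))} (hΩ : IsCompactC1Domain Ω) :
    interior Ω =ᵐ[volume] Ω :=
  interior_ae_eq_of_null_frontier hΩ.volume_frontier

theorem IsCompactC1Domain.integrableOn_frontier {n : ℕ}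
    {Ω : Set (EuclideanSpace ℝ (Fin n))} (hΩ : IsCompactC1Domain Ω) {F : Type*}
    [NormedAddCommGroup F] {g : EuclideanSpace ℝ (Fin n) → F}
    (hg : ContinuousOn g (frontier Ω)) :
    IntegrableOn g (frontier Ω) (Measure.euclideanHausdorffMeasure (n - 1)) := by
  obtain ⟨A, hA⟩ := hΩ.isCompact_frontier.exists_bound_of_continuousOn hg
  have : IsFiniteMeasure ((Measure.euclideanHausdorffMeasure (n - 1)).restrict (frontier Ω)) :=
    ⟨by rw [Measure.restrict_apply_univ]; exact hΩ.euclideanHausdorffMeasure_frontier_lt_top⟩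
  exact Integrable.of_bound
    (hg.aestronglyMeasurable_of_isCompact hΩ.isCompact_frontier isClosed_frontier.measurableSet) A
    ((ae_restrict_iff' isClosed_frontier.measurableSet).2 (Filter.Eventually.of_forall hA))

/-- The local divergence theorem in an arbitrary direction `w`, up to any relative error. -/
theorem IsCompactC1Domain.exists_nhds_abs_integral_fderiv_sub_le {k : ℕ}
    {Ω : Set (EuclideanSpace ℝ (Fin (k + 1)))} (hΩ : IsCompactC1Domain Ω)
    {x : EuclideanSpace ℝ (Fin (k + 1))} (hx : x ∈ Ω)
    (w : EuclideanSpace ℝ (Fin (k + 1))) {ε : ℝ} (hε : 0 < ε) :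
    ∃ U : Set (EuclideanSpace ℝ (Fin (k + 1))), IsOpen U ∧ x ∈ U ∧
      ∀ (f : EuclideanSpace ℝ (Fin (k + 1)) → ℝ)
        (f' : EuclideanSpace ℝ (Fin (k + 1)) → EuclideanSpace ℝ (Fin (k + 1)) →L[ℝ] ℝ),
        ContinuousOn f Ω → (∀ x ∈ interior Ω, HasFDerivAt f (f' x) x) →
        IntegrableOn f' (interior Ω) → tsupport f ⊆ U →
        |(∫ x in interior Ω, f' x w) - ∫ x in frontier Ω, f x * inner ℝ (outwardUnitNormal Ω x) w
            ∂(Measure.euclideanHausdorffMeasure k)| ≤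
        ε * ∫ x in frontier Ω, |f x| ∂(Measure.euclideanHausdorffMeasure k) := by
  by_cases hxi : x ∈ interior Ω
  -- A function supported in the interior extends by zero, and its derivative integrates to zero.
  · refine ⟨interior Ω, isOpen_interior, hxi, fun f f' hf hf' hint hsupp => ?_⟩
    have hf0 : ∀ y ∈ frontier Ω, f y = 0 := fun y hy =>
      image_eq_zero_of_notMem_tsupport fun h => hy.2 (hsupp h)
    have hdiff : Differentiable ℝ f := by
      intro y
      by_cases hy : y ∈ tsupport f
      · exact (hf' y (hsupp hy)).differentiableAt
      · exact (differentiableAt_const (0 : ℝ)).congr_of_eventuallyEq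
          (notMem_tsupport_iff_eventuallyEq.1 hy)
    have hfd : (fun y => fderiv ℝ f y w) = (interior Ω).indicator (fun y => f' y w) := by
      funext y
      by_cases hy : y ∈ interior Ω
      · rw [Set.indicator_of_mem hy, (hf' y hy).fderiv]
      · rw [Set.indicator_of_notMem hy]
        have h1 := notMem_tsupport_iff_eventuallyEq.1 fun h => hy (hsupp h)
        rw [h1.fderiv_eq]
        simp
    have hfdint : Integrable (fun y => fderiv ℝ f y w) := by
      rw [hfd, integrable_indicator_iff isOpen_interior.measurableSet]
      exact hint.apply_continuousLinearMap w
    have hcs : HasCompactSupport f :=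
      hΩ.isCompact.of_isClosed_subset (isClosed_tsupport f) (hsupp.trans interior_subset)
    have h1 := integral_mul_fderiv_eq_neg_fderiv_mul_of_integrable (μ := volume) (v := w)
      (f := fun _ : EuclideanSpace ℝ (Fin (k + 1)) => (1 : ℝ)) (g := f) (by simp)
      (by simpa using hfdint)
      (by simpa using hdiff.continuous.integrable_of_hasCompactSupport hcs)
      (fun y _ => differentiableAt_const _) (fun y _ => hdiff y)
    simp only [one_mul, fderiv_fun_const, Pi.zero_apply, zero_apply, zero_mul,
      integral_zero, neg_zero] at h1
    rw [hfd, integral_indicator isOpen_interior.measurableSet] at h1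
    have h2 : ∫ x in frontier Ω, f x * inner ℝ (outwardUnitNormal Ω x) w
        ∂(Measure.euclideanHausdorffMeasure k) = 0 :=
      setIntegral_eq_zero_of_forall_eq_zero fun y hy => by rw [hf0 y hy, zero_mul]
    rw [h1, h2, sub_zero, abs_zero]
    exact mul_nonneg hε.le (integral_nonneg fun y => abs_nonneg _)
  · have hxf : x ∈ frontier Ω := ⟨subset_closure hx, hxi⟩
    have hnorm := hΩ.norm_outwardUnitNormal hxf
    set e := outwardUnitNormal Ω x with he
    have hee : inner ℝ e e = 1 := by rw [real_inner_self_eq_norm_sq, hnorm]; norm_num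
    -- `w` is a combination of the two normalized directions `w + s • e` and `e`.
    set s : ℝ := 1 - inner ℝ e w with hs
    have hve : inner ℝ e (w + s • e) = 1 := by
      rw [inner_add_right, inner_smul_right, hee, hs]; ring
    set ε₁ := ε / (1 + |s|) with hε₁
    have hs0 : 0 < 1 + |s| := by positivity
    have hε₁0 : 0 < ε₁ := by positivity
    obtain ⟨U₁, hU₁, hxU₁, -, H₁⟩ :=
      hΩ.exists_nhds_abs_integral_sub_le_of_inner_eq_one hxf hve hε₁0
    obtain ⟨U₂, hU₂, hxU₂, -, H₂⟩ :=
      hΩ.exists_nhds_abs_integral_sub_le_of_inner_eq_one hxf hee hε₁0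
    refine ⟨U₁ ∩ U₂, hU₁.inter hU₂, ⟨hxU₁, hxU₂⟩, fun f f' hf hf' hint hsupp => ?_⟩
    have hintv : ∀ v, IntegrableOn (fun y => f' y v) (interior Ω) := fun v =>
      hint.apply_continuousLinearMap v
    have k₁ := H₁ f (fun y => f' y (w + s • e)) hf (fun y hy => (hf' y hy).hasLineDerivAt _)
      (hintv _) (hsupp.trans Set.inter_subset_left)
    have k₂ := H₂ f (fun y => f' y e) hf (fun y hy => (hf' y hy).hasLineDerivAt _)
      (hintv _) (hsupp.trans Set.inter_subset_right)
    have hfb : ∀ v, IntegrableOn (fun y => f y * inner ℝ (outwardUnitNormal Ω y) v) (frontier Ω)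
        (Measure.euclideanHausdorffMeasure k) := fun v =>
      hΩ.integrableOn_frontier ((hf.mono hΩ.isCompact.isClosed.frontier_subset).mul
        (hΩ.continuousOn_outwardUnitNormal.inner continuousOn_const))
    have e₁ : ∫ y in interior Ω, f' y (w + s • e) =
        (∫ y in interior Ω, f' y w) + s * ∫ y in interior Ω, f' y e := by
      rw [← integral_const_mul, ← integral_add (hintv w) ((hintv e).const_mul s)]
      simp
    have e₂ : ∫ y in frontier Ω, f y * inner ℝ (outwardUnitNormal Ω y) (w + s • e)
          ∂(Measure.euclideanHausdorffMeasure k) =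
        ∫ y in frontier Ω, f y * inner ℝ (outwardUnitNormal Ω y) w
          ∂(Measure.euclideanHausdorffMeasure k) +
        s * ∫ y in frontier Ω, f y * inner ℝ (outwardUnitNormal Ω y) e
          ∂(Measure.euclideanHausdorffMeasure k) := by
      rw [← integral_const_mul, ← integral_add (hfb w) ((hfb e).const_mul s)]
      congr 1 with y
      rw [inner_add_right, inner_smul_right]; ring
    rw [e₁, e₂] at k₁
    set I := ∫ y in frontier Ω, |f y| ∂(Measure.euclideanHausdorffMeasure k)
    set A := ∫ y in interior Ω, f' y w
    set A' := ∫ y in interior Ω, f' y e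
    set D := ∫ y in frontier Ω, f y * inner ℝ (outwardUnitNormal Ω y) w
          ∂(Measure.euclideanHausdorffMeasure k)
    set D' := ∫ y in frontier Ω, f y * inner ℝ (outwardUnitNormal Ω y) e
          ∂(Measure.euclideanHausdorffMeasure k)
    calc |A - D| = |(A + s * A' - (D + s * D')) - s * (A' - D')| := by ring_nf
      _ ≤ |A + s * A' - (D + s * D')| + |s * (A' - D')| := abs_sub _ _
      _ ≤ ε₁ * I + |s| * (ε₁ * I) := by
        rw [abs_mul]
        gcongr
      _ = ε * I := by rw [hε₁]; field_simp

/-! ### The divergence theorem -/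

open scoped Manifold ContDiff in
/-- A finite smooth partition of unity on a compact set, subordinate to a neighborhood of each
point. -/
theorem IsCompact.exists_smooth_partition {E : Type*} [NormedAddCommGroup E] [NormedSpace ℝ E]
    [FiniteDimensional ℝ E] {s : Set E} (hs : IsCompact s) (U : E → Set E)
    (hU : ∀ x ∈ s, IsOpen (U x) ∧ x ∈ U x) :
    ∃ (t : Finset s) (χ : t → E → ℝ), (∀ i, ContDiff ℝ 1 (χ i)) ∧ (∀ i x, 0 ≤ χ i x) ∧
      (∀ x ∈ s, ∑ i, χ i x = 1) ∧ ∀ i, tsupport (χ i) ⊆ U i := by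
  obtain ⟨t, ht⟩ := hs.elim_finite_subcover (fun i : s => U i) (fun i => (hU i i.2).1)
    fun x hx => Set.mem_iUnion.2 ⟨⟨x, hx⟩, (hU x hx).2⟩
  obtain ⟨f, hf⟩ := SmoothPartitionOfUnity.exists_isSubordinate 𝓘(ℝ, E) hs.isClosed
    (fun i : t => U i) (fun i => (hU i i.1.2).1) (by simpa [Set.iUnion_subtype] using ht)
  refine ⟨t, fun i => f i, fun i => ?_, fun i x => f.nonneg i x, fun x hx => ?_, hf⟩
  · exact ((f i).contMDiff.contDiff).of_le (by norm_cast)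
  · rw [← finsum_eq_sum_of_fintype]
    exact f.sum_eq_one hx

/-- The **divergence theorem** on a compact `C¹` domain, in a constant direction `w`, for functions
continuous up to the boundary whose derivative in the interior is integrable. -/
theorem IsCompactC1Domain.integral_fderiv_eq_integral_frontier {n : ℕ}
    {Ω : Set (EuclideanSpace ℝ (Fin n))} (hΩ : IsCompactC1Domain Ω)
    {f : EuclideanSpace ℝ (Fin n) → ℝ}
    {f' : EuclideanSpace ℝ (Fin n) → EuclideanSpace ℝ (Fin n) →L[ℝ] ℝ}
    (hf : ContinuousOn f Ω) (hf' : ∀ x ∈ interior Ω, HasFDerivAt f (f' x) x)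
    (hint : IntegrableOn f' (interior Ω)) (w : EuclideanSpace ℝ (Fin n)) :
    ∫ x in interior Ω, f' x w = ∫ x in frontier Ω, f x * inner ℝ (outwardUnitNormal Ω x) w
      ∂(Measure.euclideanHausdorffMeasure (n - 1)) := by
  cases n with
  | zero => simp [Subsingleton.elim w 0]
  | succ k =>
  rw [Nat.add_sub_cancel]
  set κ : Measure (EuclideanSpace ℝ (Fin (k + 1))) := Measure.euclideanHausdorffMeasure k with hκ
  set I := ∫ x in frontier Ω, |f x| ∂κ with hI
  have hfr : frontier Ω ⊆ Ω := hΩ.isCompact.isClosed.frontier_subset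
  have hI0 : 0 ≤ I := integral_nonneg fun x => abs_nonneg _
  suffices h : ∀ ε > 0, |(∫ x in interior Ω, f' x w) -
      ∫ x in frontier Ω, f x * inner ℝ (outwardUnitNormal Ω x) w ∂κ| ≤ ε * I by
    refine sub_eq_zero.1 (abs_eq_zero.1 (le_antisymm (le_of_forall_pos_le_add fun δ hδ => ?_)
      (abs_nonneg _)))
    refine (h (δ / (I + 1)) (by positivity)).trans ?_
    rw [zero_add, div_mul_eq_mul_div, div_le_iff₀ (by positivity)]
    nlinarith
  intro ε hε
  have hloc : ∀ x, ∃ U : Set (EuclideanSpace ℝ (Fin (k + 1))), x ∈ Ω → (IsOpen U ∧ x ∈ U ∧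
      ∀ (f : EuclideanSpace ℝ (Fin (k + 1)) → ℝ)
        (f' : EuclideanSpace ℝ (Fin (k + 1)) → EuclideanSpace ℝ (Fin (k + 1)) →L[ℝ] ℝ),
        ContinuousOn f Ω → (∀ x ∈ interior Ω, HasFDerivAt f (f' x) x) →
        IntegrableOn f' (interior Ω) → tsupport f ⊆ U →
        |(∫ x in interior Ω, f' x w) - ∫ x in frontier Ω, f x * inner ℝ (outwardUnitNormal Ω x) w
            ∂κ| ≤ ε * ∫ x in frontier Ω, |f x| ∂κ) := by
    intro x
    by_cases hx : x ∈ Ω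
    · obtain ⟨U, hU⟩ := hΩ.exists_nhds_abs_integral_fderiv_sub_le hx w hε
      exact ⟨U, fun _ => hU⟩
    · exact ⟨∅, fun h => absurd h hx⟩
  choose U hU using hloc
  obtain ⟨t, χ, hχ, hχ0, hχ1, hχU⟩ := hΩ.isCompact.exists_smooth_partition U
    fun x hx => ⟨(hU x hx).1, (hU x hx).2.1⟩
  set F : t → EuclideanSpace ℝ (Fin (k + 1)) → ℝ := fun i x => χ i x * f x with hF
  set F' : t → EuclideanSpace ℝ (Fin (k + 1)) → EuclideanSpace ℝ (Fin (k + 1)) →L[ℝ] ℝ :=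
    fun i x => χ i x • f' x + f x • fderiv ℝ (χ i) x with hF'
  have hFc : ∀ i, ContinuousOn (F i) Ω := fun i => (hχ i).continuous.continuousOn.mul hf
  have hFd : ∀ i, ∀ x ∈ interior Ω, HasFDerivAt (F i) (F' i x) x := fun i x hx =>
    ((hχ i).differentiable (by simp) x).hasFDerivAt.mul (hf' x hx)
  -- The pieces `χ i * f` are only differentiable inside `Ω`, just as `f` itself.
  have hFint : ∀ i, IntegrableOn (F' i) (interior Ω) := by
    intro i
    obtain ⟨A, hA⟩ := hΩ.isCompact.exists_bound_of_continuousOn (hχ i).continuous.continuousOn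
    have h1 : IntegrableOn (fun x => χ i x • f' x) (interior Ω) :=
      hint.bdd_smul A ((hχ i).continuous.aestronglyMeasurable)
        ((ae_restrict_iff' isOpen_interior.measurableSet).2
          (Filter.Eventually.of_forall fun x hx => hA x (interior_subset hx)))
    have h2 : ContinuousOn (fun x => f x • fderiv ℝ (χ i) x) Ω :=
      hf.smul ((hχ i).continuous_fderiv (by simp)).continuousOn
    exact h1.add ((h2.integrableOn_compact hΩ.isCompact).mono_set interior_subset)
  have hFU : ∀ i, tsupport (F i) ⊆ U i := fun i =>
    (tsupport_mul_subset_left (f := χ i) (g := f)).trans (hχU i)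
  have hest := fun i : t => (hU i i.1.2).2.2 (F i) (F' i) (hFc i) (hFd i) (hFint i) (hFU i)
  have hsumF : ∀ x ∈ Ω, ∑ i, F i x = f x := fun x hx => by
    simp only [hF]
    rw [← Finset.sum_mul, hχ1 x hx, one_mul]
  have hsumF' : ∀ x ∈ interior Ω, ∑ i, F' i x = f' x := by
    intro x hx
    have h1 : HasFDerivAt (fun y => ∑ i, F i y) (∑ i, F' i x) x :=
      HasFDerivAt.fun_sum fun i _ => hFd i x hx
    refine (h1.congr_of_eventuallyEq ?_).unique (hf' x hx)
    filter_upwards [isOpen_interior.mem_nhds hx] with y hy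
    exact (hsumF y (interior_subset hy)).symm
  have e₁ : ∫ x in interior Ω, f' x w = ∑ i, ∫ x in interior Ω, F' i x w := by
    rw [← integral_finsetSum _ fun i _ => (hFint i).apply_continuousLinearMap w]
    refine setIntegral_congr_fun isOpen_interior.measurableSet fun x hx => ?_
    simp only [← hsumF' x hx, sum_apply]
  have hbint : ∀ i, IntegrableOn (fun x => F i x * inner ℝ (outwardUnitNormal Ω x) w)
      (frontier Ω) κ := fun i => hΩ.integrableOn_frontier
    (((hFc i).mono hfr).mul (hΩ.continuousOn_outwardUnitNormal.inner continuousOn_const))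
  have e₂ : ∫ x in frontier Ω, f x * inner ℝ (outwardUnitNormal Ω x) w ∂κ =
      ∑ i, ∫ x in frontier Ω, F i x * inner ℝ (outwardUnitNormal Ω x) w ∂κ := by
    rw [← integral_finsetSum _ fun i _ => hbint i]
    refine setIntegral_congr_fun isClosed_frontier.measurableSet fun x hx => ?_
    simp only [← Finset.sum_mul, hsumF x (hfr hx)]
  have hbabs : ∀ i, IntegrableOn (fun x => |F i x|) (frontier Ω) κ := fun i =>
    hΩ.integrableOn_frontier ((hFc i).mono hfr).abs
  have e₃ : I = ∑ i, ∫ x in frontier Ω, |F i x| ∂κ := by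
    rw [hI, ← integral_finsetSum _ fun i _ => hbabs i]
    refine setIntegral_congr_fun isClosed_frontier.measurableSet fun x hx => ?_
    simp only [hF, abs_mul, abs_of_nonneg (hχ0 _ x)]
    rw [← Finset.sum_mul, hχ1 x (hfr hx), one_mul]
  rw [e₁, e₂, e₃, ← Finset.sum_sub_distrib, Finset.mul_sum]
  exact (Finset.abs_sum_le_sum_abs _ _).trans (Finset.sum_le_sum fun i _ => hest i)

/-! ### Differentiation under the integral sign, derivative of the determinant -/

/-- The derivative of a function that is `C¹` up to the boundary of `S` is bounded on the interior
of `S`, near each compact subset of `S`. -/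
theorem ContDiffOn.exists_bound_fderiv {E F : Type*} [NormedAddCommGroup E] [NormedSpace ℝ E]
    [NormedAddCommGroup F] [NormedSpace ℝ F] {g : E → F} {S K : Set E} (hg : ContDiffOn ℝ 1 g S)
    (hK : IsCompact K) (hKS : K ⊆ S) :
    ∃ (A : ℝ) (O : Set E), IsOpen O ∧ K ⊆ O ∧ ∀ q ∈ O ∩ interior S, ‖fderiv ℝ g q‖ ≤ A := by
  refine hK.induction_on (p := fun T => ∃ (A : ℝ) (O : Set E), IsOpen O ∧ T ⊆ O ∧
    ∀ q ∈ O ∩ interior S, ‖fderiv ℝ g q‖ ≤ A) ⟨0, ∅, isOpen_empty, le_rfl, by simp⟩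
    (fun s t hst ⟨A, O, hO, htO, h⟩ => ⟨A, O, hO, hst.trans htO, h⟩) ?_ ?_
  · rintro s t ⟨A, O, hO, hsO, h⟩ ⟨A', O', hO', htO, h'⟩
    refine ⟨max A A', O ∪ O', hO.union hO', Set.union_subset_union hsO htO, ?_⟩
    rintro q ⟨hq | hq, hqS⟩
    · exact (h q ⟨hq, hqS⟩).trans (le_max_left _ _)
    · exact (h' q ⟨hq, hqS⟩).trans (le_max_right _ _)
  · intro x hx
    have hgx := hg x (hKS hx)
    rw [← zero_add (1 : WithTop ℕ∞), contDiffWithinAt_succ_iff_hasFDerivWithinAt (by simp)] at hgx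
    obtain ⟨u, hu, -, f', hf', hfc⟩ := hgx
    rw [Set.insert_eq_of_mem (hKS hx)] at hu
    have hb : ∀ᶠ y in 𝓝[u] x, ‖f' y‖ < ‖f' x‖ + 1 :=
      hfc.continuousWithinAt.norm.eventually_lt_const (by linarith)
    obtain ⟨O₁, hO₁, hxO₁, hs₁⟩ := mem_nhdsWithin.1 hu
    obtain ⟨O₂, hO₂, hxO₂, hs₂⟩ := mem_nhdsWithin.1 hb
    refine ⟨O₁ ∩ O₂, mem_nhdsWithin_of_mem_nhds ((hO₁.inter hO₂).mem_nhds ⟨hxO₁, hxO₂⟩),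
      ‖f' x‖ + 1, O₁ ∩ O₂, hO₁.inter hO₂, le_rfl, ?_⟩
    rintro q ⟨⟨hq₁, hq₂⟩, hqS⟩
    have hqu : u ∈ 𝓝 q := by
      filter_upwards [(hO₁.inter isOpen_interior).mem_nhds ⟨hq₁, hqS⟩] with y hy
      exact hs₁ ⟨hy.1, interior_subset hy.2⟩
    have hqu' := mem_of_mem_nhds hqu
    rw [((hf' q hqu').hasFDerivAt hqu).fderiv]
    exact le_of_lt (hs₂ ⟨hq₂, hqu'⟩)

/-- Differentiation under the integral sign over a fixed compact set `Ω` with null frontier, for an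
integrand that is `C¹` on `P × Ω`, up to the boundary of `Ω`. -/
theorem ContDiffOn.hasFDerivAt_setIntegral {E F : Type*} [NormedAddCommGroup E] [NormedSpace ℝ E]
    [NormedAddCommGroup F] [NormedSpace ℝ F] [SecondCountableTopology F] [MeasurableSpace F]
    [BorelSpace F] {μ : Measure F}
    [IsFiniteMeasureOnCompacts μ] {P : Set E} (hP : IsOpen P) {Ω : Set F} (hΩ : IsCompact Ω)
    (hfr : interior Ω =ᵐ[μ] Ω) {h : E × F → ℝ} (hh : ContDiffOn ℝ 1 h (P ×ˢ Ω)) {C : E}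
    (hC : C ∈ P) :
    IntegrableOn (fun X => fderiv ℝ (fun C' => h (C', X)) C) (interior Ω) μ ∧
    HasFDerivAt (fun C' => ∫ X in Ω, h (C', X) ∂μ)
      (∫ X in interior Ω, fderiv ℝ (fun C' => h (C', X)) C ∂μ) C := by
  have hint : interior (P ×ˢ Ω) = P ×ˢ interior Ω := by rw [interior_prod_eq, hP.interior_eq]
  have hopen : IsOpen (P ×ˢ interior Ω) := hP.prod isOpen_interior
  have hh' : ContDiffOn ℝ 1 h (P ×ˢ interior Ω) :=
    hh.mono (Set.prod_mono le_rfl interior_subset)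
  obtain ⟨A, O, hO, hKO, hA⟩ := hh.exists_bound_fderiv (isCompact_singleton.prod hΩ)
    (Set.prod_mono (Set.singleton_subset_iff.2 hC) le_rfl)
  obtain ⟨u, v, hu, -, hCu, hΩv, huv⟩ := generalized_tube_lemma isCompact_singleton hΩ hO hKO
  set F' : E → F → E →L[ℝ] ℝ := fun C' X =>
    (fderiv ℝ h (C', X)).comp (ContinuousLinearMap.inl ℝ E F) with hF'
  have hderiv : ∀ C' ∈ P, ∀ X ∈ interior Ω, HasFDerivAt (fun C' => h (C', X)) (F' C' X) C' := by
    intro C' hC' X hX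
    have h1 : HasFDerivAt h (fderiv ℝ h (C', X)) (C', X) :=
      ((hh'.contDiffAt (hopen.mem_nhds ⟨hC', hX⟩)).differentiableAt (by simp)).hasFDerivAt
    exact h1.comp C' (hasFDerivAt_prodMk_left C' X)
  have hbound : ∀ C' ∈ u ∩ P, ∀ X ∈ interior Ω,
      ‖F' C' X‖ ≤ A * ‖ContinuousLinearMap.inl ℝ E F‖ := by
    intro C' hC' X hX
    refine (ContinuousLinearMap.opNorm_comp_le _ _).trans ?_
    gcongr
    refine hA _ ⟨huv ⟨hC'.1, hΩv (interior_subset hX)⟩, ?_⟩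
    rw [hint]
    exact ⟨hC'.2, hX⟩
  have hmeas : MeasurableSet (interior Ω) := isOpen_interior.measurableSet
  have hfin : μ (interior Ω) < ⊤ := (measure_mono interior_subset).trans_lt hΩ.measure_lt_top
  have hF'c : ContinuousOn (F' C) (interior Ω) := by
    have h1 : ContinuousOn (fun X => fderiv ℝ h (C, X)) (interior Ω) :=
      (hh'.continuousOn_fderiv_of_isOpen hopen le_rfl).comp (by fun_prop) fun X hX => ⟨hC, hX⟩
    exact h1.clm_comp continuousOn_const
  have hFc : ∀ C' ∈ P, ContinuousOn (fun X => h (C', X)) Ω := fun C' hC' =>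
    hh.continuousOn.comp (by fun_prop) fun X hX => ⟨hC', hX⟩
  have hCuP : u ∩ P ∈ 𝓝 C := (hu.inter hP).mem_nhds ⟨hCu rfl, hC⟩
  have hfd : ∀ X ∈ interior Ω, fderiv ℝ (fun C' => h (C', X)) C = F' C X := fun X hX =>
    (hderiv C hC X hX).fderiv
  have hmeasF' : AEStronglyMeasurable (F' C) (μ.restrict (interior Ω)) :=
    hF'c.aestronglyMeasurable hmeas
  have hintF' : IntegrableOn (F' C) (interior Ω) μ := by
    have : IsFiniteMeasure (μ.restrict (interior Ω)) := ⟨by rwa [Measure.restrict_apply_univ]⟩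
    exact Integrable.of_bound hmeasF' _ ((ae_restrict_iff' hmeas).2
      (Filter.Eventually.of_forall (hbound C (mem_of_mem_nhds hCuP))))
  refine ⟨hintF'.congr_fun (fun X hX => (hfd X hX).symm) hmeas, ?_⟩
  rw [setIntegral_congr_fun hmeas hfd]
  simp_rw [← setIntegral_congr_set hfr]
  refine hasFDerivAt_integral_of_dominated_of_fderiv_le (F' := F')
    (bound := fun _ => A * ‖ContinuousLinearMap.inl ℝ E F‖) hCuP ?_ ?_ hmeasF' ?_ ?_ ?_
  · filter_upwards [hCuP] with C' hC'
    exact ((hFc C' hC'.2).mono interior_subset).aestronglyMeasurable hmeas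
  · exact ((hFc C hC).integrableOn_compact hΩ).mono_set interior_subset
  · exact (ae_restrict_iff' hmeas).2
      (Filter.Eventually.of_forall fun X hX C' hC' => hbound C' hC' X hX)
  · exact integrableOn_const hfin.ne
  · exact (ae_restrict_iff' hmeas).2
      (Filter.Eventually.of_forall fun X hX C' hC' => hderiv C' hC'.2 X hX)

theorem ContinuousLinearMap.det_eq_det_of_single {n : ℕ}
    (A : EuclideanSpace ℝ (Fin n) →L[ℝ] EuclideanSpace ℝ (Fin n)) :
    A.det = (Matrix.of fun i j => A (EuclideanSpace.single j 1) i).det := by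
  rw [ContinuousLinearMap.det, ← LinearMap.det_toMatrix (EuclideanSpace.basisFun (Fin n) ℝ).toBasis]
  congr 1

theorem contDiff_continuousLinearMap_det {n : ℕ} {k : WithTop ℕ∞} : ContDiff ℝ k
    (fun A : EuclideanSpace ℝ (Fin n) →L[ℝ] EuclideanSpace ℝ (Fin n) => A.det) := by
  simp_rw [ContinuousLinearMap.det_eq_det_of_single, Matrix.det_apply]
  refine ContDiff.sum fun σ _ => ContDiff.const_smul _ (contDiff_prod fun i _ => ?_)
  simp only [Matrix.of_apply]
  fun_prop

/-- The derivative of the determinant at the identity is the trace. -/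
theorem fderiv_det_id_apply {n : ℕ}
    (B : EuclideanSpace ℝ (Fin n) →L[ℝ] EuclideanSpace ℝ (Fin n)) :
    fderiv ℝ (fun A : EuclideanSpace ℝ (Fin n) →L[ℝ] EuclideanSpace ℝ (Fin n) => A.det)
      (ContinuousLinearMap.id ℝ _) B = ∑ j, B (EuclideanSpace.single j 1) j := by
  have h1 := (contDiff_continuousLinearMap_det (n := n) (k := 1)).differentiable (by simp)
    (ContinuousLinearMap.id ℝ _)
  have h2 := (h1.hasFDerivAt.hasLineDerivAt B).lineDeriv
  rw [← h2, lineDeriv]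
  set M : Matrix (Fin n) (Fin n) ℝ := Matrix.of fun i j => B (EuclideanSpace.single j 1) i with hM
  set p := (Matrix.det (1 + (Polynomial.X : Polynomial ℝ) • M.map Polynomial.C)).divX.divX
  have h3 : (fun t : ℝ => (ContinuousLinearMap.id ℝ (EuclideanSpace ℝ (Fin n)) + t • B).det) =
      fun t => 1 + M.trace * t + p.eval t * t ^ 2 := by
    funext t
    rw [ContinuousLinearMap.det_eq_det_of_single, ← Matrix.det_one_add_smul]
    congr 1
    ext i j
    simp [hM, Matrix.one_apply]
  have h4 : HasDerivAt (fun t : ℝ => 1 + M.trace * t + p.eval t * t ^ 2) M.trace 0 := by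
    have := (((hasDerivAt_id (0 : ℝ)).const_mul M.trace).const_add 1).add
      ((p.hasDerivAt 0).mul ((hasDerivAt_id (0 : ℝ)).pow 2))
    refine this.congr_deriv ?_
    simp
  rw [h3, h4.deriv]
  simp [hM, Matrix.trace]

/-! ### Diffeomorphisms and domains -/

/-- A `Cⁿ` injective map with invertible derivatives has open image and a `Cⁿ` inverse. -/
theorem ContDiffOn.isOpen_image_and_contDiffOn_invFunOn {E F : Type*} [NormedAddCommGroup E]
    [NormedSpace ℝ E] [CompleteSpace E] [NormedAddCommGroup F] [NormedSpace ℝ F] {f : E → F}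
    {M : Set E} {n : WithTop ℕ∞} (hM : IsOpen M) (hf : ContDiffOn ℝ n f M) (hn : n ≠ 0)
    (hinj : Set.InjOn f M) (hinv : ∀ s ∈ M, (fderiv ℝ f s).IsInvertible) :
    IsOpen (f '' M) ∧ ContDiffOn ℝ n (Function.invFunOn f M) (f '' M) := by
  have hat : ∀ s ∈ M, ContDiffAt ℝ n f s := fun s hs => hf.contDiffAt (hM.mem_nhds hs)
  constructor
  · rw [isOpen_iff_mem_nhds]
    rintro _ ⟨s, hs, rfl⟩
    obtain ⟨e, he⟩ := hinv s hs
    have h1 : HasStrictFDerivAt f (e : E →L[ℝ] F) s := by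
      rw [he]; exact (hat s hs).hasStrictFDerivAt hn
    rw [← h1.map_nhds_eq_of_equiv]
    exact Filter.image_mem_map (hM.mem_nhds hs)
  · rintro _ ⟨s, hs, rfl⟩
    obtain ⟨e, he⟩ := hinv s hs
    have h1 : HasFDerivAt f (e : E →L[ℝ] F) s := by
      rw [he]; exact ((hat s hs).differentiableAt hn).hasFDerivAt
    have h2 : HasStrictFDerivAt f (e : E →L[ℝ] F) s := (hat s hs).hasStrictFDerivAt' h1 hn
    have hc := (hat s hs).to_localInverse h1 hn
    have hs' : (hat s hs).localInverse h1 hn (f s) = s := (hat s hs).localInverse_apply_image h1 hn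
    refine (hc.congr_of_eventuallyEq ?_).contDiffWithinAt
    have h3 : ∀ᶠ X in 𝓝 (f s), (hat s hs).localInverse h1 hn X ∈ M :=
      hc.continuousAt.eventually_mem (by rw [hs']; exact hM.mem_nhds hs)
    filter_upwards [h3, h2.eventually_right_inverse] with X hX hX'
    have hXM : X ∈ f '' M := ⟨_, hX, hX'⟩
    refine hinj (Function.invFunOn_mem hXM) hX ?_
    rw [Function.invFunOn_eq hXM]
    exact hX'.symm

/-- Compact `C¹` domains are preserved by `C¹` diffeomorphisms onto the image. -/
theorem IsCompactC1Domain.image {n : ℕ} {Ω M : Set (EuclideanSpace ℝ (Fin n))}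
    (hΩ : IsCompactC1Domain Ω) (hM : IsOpen M) (hΩM : Ω ⊆ M)
    {f : EuclideanSpace ℝ (Fin n) → EuclideanSpace ℝ (Fin n)} (hf : ContDiffOn ℝ 1 f M)
    (hinj : Set.InjOn f M) (hinv : ∀ s ∈ M, (fderiv ℝ f s).IsInvertible) :
    IsCompactC1Domain (f '' Ω) := by
  obtain ⟨hN, hσ⟩ := hf.isOpen_image_and_contDiffOn_invFunOn hM one_ne_zero hinj hinv
  set σ := Function.invFunOn f M with hσdef
  have hσf : ∀ s ∈ M, σ (f s) = s := fun s hs => hinj.leftInvOn_invFunOn hs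
  have hfσ : ∀ X ∈ f '' M, f (σ X) = X := fun X hX => Function.invFunOn_eq hX
  have hcpt : IsCompact (f '' Ω) := hΩ.isCompact.image_of_continuousOn (hf.continuousOn.mono hΩM)
  refine ⟨hcpt, fun x hx => ?_⟩
  obtain ⟨s, hs, rfl⟩ := hcpt.isClosed.frontier_subset hx
  have hsM := hΩM hs
  -- Interior points are mapped to interior points, so `s` is a boundary point.
  have hfr : s ∈ frontier Ω := by
    refine ⟨subset_closure hs, fun hsi => hx.2 ?_⟩
    have ho := ((hf.mono (interior_subset.trans hΩM)).isOpen_image_and_contDiffOn_invFunOn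
      isOpen_interior one_ne_zero (hinj.mono (interior_subset.trans hΩM))
      fun y hy => hinv y (hΩM (interior_subset hy))).1
    exact interior_maximal (Set.image_mono interior_subset) ho ⟨s, hsi, rfl⟩
  obtain ⟨ρ, U, hU, hsU, hρ, h0, hne, heq⟩ := hΩ.boundary s hfr
  have hUN : IsOpen (f '' M ∩ σ ⁻¹' U) := hσ.continuousOn.isOpen_inter_preimage hN hU
  have hxN : f s ∈ f '' M := ⟨s, hsM, rfl⟩
  refine ⟨ρ ∘ σ, f '' M ∩ σ ⁻¹' U, hUN, ⟨hxN, by simpa [hσf s hsM] using hsU⟩,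
    hρ.comp (hσ.mono Set.inter_subset_left) fun X hX => hX.2, by simp [hσf s hsM, h0], ?_, ?_⟩
  · -- Otherwise the derivative of `ρ = (ρ ∘ σ) ∘ f` at `s` would vanish.
    intro hg
    apply hne
    have hσd : DifferentiableAt ℝ σ (f s) :=
      (hσ.contDiffAt (hN.mem_nhds hxN)).differentiableAt (by simp)
    have hρd : DifferentiableAt ℝ ρ (σ (f s)) := by
      rw [hσf s hsM]
      exact (hρ.contDiffAt (hU.mem_nhds hsU)).differentiableAt (by simp)
    have hfd : DifferentiableAt ℝ f s :=
      (hf.contDiffAt (hM.mem_nhds hsM)).differentiableAt (by simp)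
    have hcd : HasFDerivAt (ρ ∘ σ) (fderiv ℝ (ρ ∘ σ) (f s)) (f s) :=
      (hρd.comp _ hσd).hasFDerivAt
    have hz : fderiv ℝ (ρ ∘ σ) (f s) = 0 := by
      simpa [gradient] using hg
    rw [hz] at hcd
    have h1 : HasFDerivAt ((ρ ∘ σ) ∘ f) (0 : EuclideanSpace ℝ (Fin n) →L[ℝ] ℝ) s := by
      simpa using hcd.comp s hfd.hasFDerivAt
    have h2 : HasFDerivAt ρ (0 : EuclideanSpace ℝ (Fin n) →L[ℝ] ℝ) s := by
      refine h1.congr_of_eventuallyEq ?_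
      filter_upwards [hM.mem_nhds hsM] with y hy
      simp [hσf y hy]
    simp [gradient, h2.fderiv]
  · have hiff : ∀ z ∈ U, (z ∈ Ω ↔ ρ z ≤ 0) := fun z hz => by
      have := Set.ext_iff.1 heq z
      simpa [hz] using this
    ext X
    constructor
    · rintro ⟨⟨y, hy, rfl⟩, hyN, hyU⟩
      refine ⟨⟨hyN, hyU⟩, (hiff _ hyU).1 ?_⟩
      rwa [hσf y (hΩM hy)]
    · rintro ⟨⟨hXN, hXU⟩, hle⟩
      exact ⟨⟨σ X, (hiff _ hXU).2 hle, hfσ X hXN⟩, hXN, hXU⟩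

/-! ### Divergence of matrix fields and the infinitesimal change of variables -/

theorem ContDiffOn.integrableOn_fderiv_interior {E F : Type*} [NormedAddCommGroup E]
    [NormedSpace ℝ E] [SecondCountableTopology E] [MeasurableSpace E] [BorelSpace E]
    [NormedAddCommGroup F] [NormedSpace ℝ F] {μ : Measure E}
    [IsFiniteMeasureOnCompacts μ] {Ω : Set E} (hΩ : IsCompact Ω) {g : E → F}
    (hg : ContDiffOn ℝ 1 g Ω) : IntegrableOn (fderiv ℝ g) (interior Ω) μ := by
  obtain ⟨A, O, -, hO, hA⟩ := hg.exists_bound_fderiv hΩ le_rfl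
  have hmeas : MeasurableSet (interior Ω) := isOpen_interior.measurableSet
  have : IsFiniteMeasure (μ.restrict (interior Ω)) := ⟨by
    rw [Measure.restrict_apply_univ]
    exact (measure_mono interior_subset).trans_lt hΩ.measure_lt_top⟩
  exact Integrable.of_bound
    (((hg.mono interior_subset).continuousOn_fderiv_of_isOpen isOpen_interior
      le_rfl).aestronglyMeasurable hmeas) A ((ae_restrict_iff' hmeas).2
      (Filter.Eventually.of_forall fun X hX => hA X ⟨hO (interior_subset hX), hX⟩))

theorem matrixDivergence_eq_sum {m n : ℕ}
    (T : EuclideanSpace ℝ (Fin n) → Matrix (Fin n) (Fin m) ℝ) (X : EuclideanSpace ℝ (Fin n)) :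
    matrixDivergence T X = ∑ c, ∑ j, fderiv ℝ (fun Y => T Y j c) X (EuclideanSpace.single j 1) •
      (EuclideanSpace.single c 1 : EuclideanSpace ℝ (Fin m)) := by
  ext c
  simp [matrixDivergence, ← Finset.sum_smul, Finset.sum_apply, Pi.single_apply]

theorem matrixDot_eq_sum {m n : ℕ} (T : Matrix (Fin n) (Fin m) ℝ)
    (ν : EuclideanSpace ℝ (Fin n)) :
    matrixDot T ν = ∑ c, ∑ j, (T j c * inner ℝ ν (EuclideanSpace.single j 1)) •
      (EuclideanSpace.single c 1 : EuclideanSpace ℝ (Fin m)) := by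
  ext c
  simp [matrixDot, ← Finset.sum_smul, Finset.sum_apply, Pi.single_apply,
    EuclideanSpace.inner_single_right]

/-- The **divergence theorem** for matrix fields that are `C¹` up to the boundary. -/
theorem IsCompactC1Domain.integral_matrixDivergence {m n : ℕ}
    {Ω : Set (EuclideanSpace ℝ (Fin n))} (hΩ : IsCompactC1Domain Ω)
    {T : EuclideanSpace ℝ (Fin n) → Matrix (Fin n) (Fin m) ℝ}
    (hT : ∀ j c, ContDiffOn ℝ 1 (fun Y => T Y j c) Ω) :
    IntegrableOn (fun X => matrixDot (T X) (outwardUnitNormal Ω X)) (frontier Ω)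
      (Measure.euclideanHausdorffMeasure (n - 1)) ∧
    IntegrableOn (matrixDivergence T) Ω ∧
    ∫ X in Ω, matrixDivergence T X = ∫ X in frontier Ω, matrixDot (T X) (outwardUnitNormal Ω X)
      ∂(Measure.euclideanHausdorffMeasure (n - 1)) := by
  have hb : ∀ c j, IntegrableOn (fun X => (T X j c * inner ℝ (outwardUnitNormal Ω X)
      (EuclideanSpace.single j 1)) • (EuclideanSpace.single c 1 : EuclideanSpace ℝ (Fin m)))
      (frontier Ω) (Measure.euclideanHausdorffMeasure (n - 1)) := fun c j =>
    (hΩ.integrableOn_frontier (((hT j c).continuousOn.mono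
      hΩ.isCompact.isClosed.frontier_subset).mul
      (hΩ.continuousOn_outwardUnitNormal.inner continuousOn_const))).smul_const _
  have hd : ∀ c j, IntegrableOn (fun X => fderiv ℝ (fun Y => T Y j c) X
      (EuclideanSpace.single j 1) • (EuclideanSpace.single c 1 : EuclideanSpace ℝ (Fin m)))
      (interior Ω) := fun c j =>
    (((hT j c).integrableOn_fderiv_interior hΩ.isCompact).apply_continuousLinearMap
      _).smul_const _
  rw [← integrableOn_congr_set_ae hΩ.interior_ae_eq, ← setIntegral_congr_set hΩ.interior_ae_eq,
    funext (matrixDivergence_eq_sum T)]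
  simp_rw [matrixDot_eq_sum]
  refine ⟨integrable_finsetSum _ fun c _ => integrable_finsetSum _ fun j _ => hb c j,
    integrable_finsetSum _ fun c _ => integrable_finsetSum _ fun j _ => hd c j, ?_⟩
  rw [integral_finsetSum _ fun c _ => integrable_finsetSum _ fun j _ => hd c j,
    integral_finsetSum _ fun c _ => integrable_finsetSum _ fun j _ => hb c j]
  refine Finset.sum_congr rfl fun c _ => ?_
  rw [integral_finsetSum _ fun j _ => hd c j, integral_finsetSum _ fun j _ => hb c j]
  refine Finset.sum_congr rfl fun j _ => ?_
  rw [integral_smul_const, integral_smul_const,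
    hΩ.integral_fderiv_eq_integral_frontier (hT j c).continuousOn (fun X hX => ?_)
      ((hT j c).integrableOn_fderiv_interior hΩ.isCompact)]
  exact (((hT j c).contDiffAt (mem_interior_iff_mem_nhds.1 hX)).differentiableAt
    (by simp)).hasFDerivAt

/-- The infinitesimal change of variables: the derivative at `C`, where `χ C` is the identity, of
the density `β` transported by the motion `χ`, times the Jacobian of the motion. Symmetry of the
mixed second derivatives of `χ` turns the derivative of the Jacobian into the divergence of the
velocity. -/
theorem fderiv_mul_abs_det_fderiv_apply {G : Type*} [NormedAddCommGroup G] [NormedSpace ℝ G] {n : ℕ}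
    {P : Set G} {N : Set (EuclideanSpace ℝ (Fin n))} (hP : IsOpen P) (hN : IsOpen N)
    {χ : G → EuclideanSpace ℝ (Fin n) → EuclideanSpace ℝ (Fin n)}
    (hχ : ContDiffOn ℝ 2 (fun q : G × EuclideanSpace ℝ (Fin n) => χ q.1 q.2) (P ×ˢ N))
    {C : G} (hC : C ∈ P) (hid : ∀ X ∈ N, χ C X = X) {X : EuclideanSpace ℝ (Fin n)} (hX : X ∈ N)
    {b : EuclideanSpace ℝ (Fin n) → G → ℝ}
    (hb : DifferentiableAt ℝ (fun q : EuclideanSpace ℝ (Fin n) × G => b q.1 q.2) (X, C)) (w : G) :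
    fderiv ℝ (fun C' => b (χ C' X) C' * |(fderiv ℝ (χ C') X).det|) C w =
      fderiv ℝ (b X) C w +
      ∑ j, fderiv ℝ (fun Y => b Y C * fderiv ℝ (fun C' => χ C' Y) C w j) X
        (EuclideanSpace.single j 1) := by
  set χ' : G × EuclideanSpace ℝ (Fin n) → EuclideanSpace ℝ (Fin n) := fun q => χ q.1 q.2 with hχ'
  set β : EuclideanSpace ℝ (Fin n) × G → ℝ := fun q => b q.1 q.2 with hβ
  have hopen : IsOpen (P ×ˢ N) := hP.prod hN
  have hat : ∀ q ∈ P ×ˢ N, HasFDerivAt χ' (fderiv ℝ χ' q) q := fun q hq =>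
    ((hχ.contDiffAt (hopen.mem_nhds hq)).differentiableAt (by simp)).hasFDerivAt
  have hq : (C, X) ∈ P ×ˢ N := ⟨hC, hX⟩
  have hcd : ContDiffAt ℝ 2 χ' (C, X) := hχ.contDiffAt (hopen.mem_nhds hq)
  have hsymm : IsSymmSndFDerivAt ℝ χ' (C, X) := hcd.isSymmSndFDerivAt (by simp)
  have hD : HasFDerivAt (fderiv ℝ χ') (fderiv ℝ (fderiv ℝ χ') (C, X)) (C, X) :=
    ((hcd.fderiv_right (m := 1) (by norm_num)).differentiableAt (by simp)).hasFDerivAt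
  set D2 := fderiv ℝ (fderiv ℝ χ') (C, X) with hD2
  have hXd : ∀ C' ∈ P, ∀ Y ∈ N, HasFDerivAt (χ C')
      ((fderiv ℝ χ' (C', Y)).comp (ContinuousLinearMap.inr ℝ G _)) Y := fun C' hC' Y hY =>
    HasFDerivAt.comp Y (f := fun Y => (C', Y)) (hat (C', Y) ⟨hC', hY⟩)
      (hasFDerivAt_prodMk_right C' Y)
  have hCd : ∀ Y ∈ N, HasFDerivAt (fun C' => χ C' Y)
      ((fderiv ℝ χ' (C, Y)).comp (ContinuousLinearMap.inl ℝ G _)) C := fun Y hY =>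
    HasFDerivAt.comp C (f := fun C' => (C', Y)) (hat (C, Y) ⟨hC, hY⟩) (hasFDerivAt_prodMk_left C Y)
  have hone : fderiv ℝ (χ C) X = ContinuousLinearMap.id ℝ _ := by
    refine ((hasFDerivAt_id X).congr_of_eventuallyEq ?_).fderiv
    filter_upwards [hN.mem_nhds hX] with Y hY
    exact hid Y hY
  -- The velocity at `C`, in the direction `w`, as a vector field.
  have hV : HasFDerivAt (fun Y => fderiv ℝ (fun C' => χ C' Y) C w)
      ((ContinuousLinearMap.apply ℝ _ ((w, 0) : G × EuclideanSpace ℝ (Fin n))).comp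
        (D2.comp (ContinuousLinearMap.inr ℝ G _))) X := by
    have h1 : HasFDerivAt (fun Y => fderiv ℝ χ' (C, Y))
        (D2.comp (ContinuousLinearMap.inr ℝ G _)) X :=
      HasFDerivAt.comp X hD (hasFDerivAt_prodMk_right C X)
    refine ((ContinuousLinearMap.apply ℝ (EuclideanSpace ℝ (Fin n))
      ((w, 0) : G × EuclideanSpace ℝ (Fin n))).hasFDerivAt.comp X h1).congr_of_eventuallyEq ?_
    filter_upwards [hN.mem_nhds hX] with Y hY
    rw [(hCd Y hY).fderiv]
    simp
  -- The spatial derivative of `χ C'`, as a function of `C'`.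
  have hJ : HasFDerivAt (fun C' => fderiv ℝ (χ C') X)
      (((ContinuousLinearMap.compL ℝ _ _ _).flip (ContinuousLinearMap.inr ℝ G _)).comp
        (D2.comp (ContinuousLinearMap.inl ℝ G _))) C := by
    have h1 : HasFDerivAt (fun C' => fderiv ℝ χ' (C', X))
        (D2.comp (ContinuousLinearMap.inl ℝ G _)) C :=
      HasFDerivAt.comp C hD (hasFDerivAt_prodMk_left C X)
    refine (((ContinuousLinearMap.compL ℝ (EuclideanSpace ℝ (Fin n))
      (G × EuclideanSpace ℝ (Fin n)) (EuclideanSpace ℝ (Fin n))).flip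
      (ContinuousLinearMap.inr ℝ G _)).hasFDerivAt.comp C h1).congr_of_eventuallyEq ?_
    filter_upwards [hP.mem_nhds hC] with C' hC'
    rw [(hXd C' hC' X hX).fderiv]
    simp
  have hdet : HasFDerivAt (fun A : EuclideanSpace ℝ (Fin n) →L[ℝ] EuclideanSpace ℝ (Fin n) =>
      A.det) (fderiv ℝ (fun A : EuclideanSpace ℝ (Fin n) →L[ℝ] EuclideanSpace ℝ (Fin n) =>
      A.det) (ContinuousLinearMap.id ℝ _)) (fderiv ℝ (χ C) X) := by
    rw [hone]
    exact ((contDiff_continuousLinearMap_det (n := n) (k := 1)).differentiable (by simp)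
      _).hasFDerivAt
  have hdetJ := hdet.comp C hJ
  have hdet1 : (fderiv ℝ (χ C) X).det = 1 := by
    rw [hone, ContinuousLinearMap.det]
    exact LinearMap.det_id
  -- The Jacobian is near `1`, so the absolute value does not matter near `C`.
  have hpos : ∀ᶠ C' in 𝓝 C, 0 < (fderiv ℝ (χ C') X).det := by
    refine hdetJ.continuousAt.eventually_const_lt ?_
    simp [hdet1]
  have habs := hdetJ.congr_of_eventuallyEq (f₁ := fun C' => |(fderiv ℝ (χ C') X).det|)
    (hpos.mono fun C' h => abs_of_pos h)
  have hbC : HasFDerivAt (fun C' => b (χ C' X) C') ((fderiv ℝ β (X, C)).comp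
      (((fderiv ℝ χ' (C, X)).comp (ContinuousLinearMap.inl ℝ G _)).prod
        (ContinuousLinearMap.id ℝ G))) C := by
    have h1 : HasFDerivAt β (fderiv ℝ β (X, C)) (χ C X, C) := by
      rw [hid X hX]; exact hb.hasFDerivAt
    exact HasFDerivAt.comp C (f := fun C' => (χ C' X, C')) h1 ((hCd X hX).prodMk (hasFDerivAt_id C))
  have hbX : HasFDerivAt (fun Y => b Y C) ((fderiv ℝ β (X, C)).comp
      (ContinuousLinearMap.inl ℝ _ G)) X :=
    HasFDerivAt.comp X (f := fun Y => (Y, C)) hb.hasFDerivAt (hasFDerivAt_prodMk_left X C)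
  have hbC' : HasFDerivAt (b X) ((fderiv ℝ β (X, C)).comp
      (ContinuousLinearMap.inr ℝ _ G)) C :=
    HasFDerivAt.comp C (f := fun C' => (X, C')) hb.hasFDerivAt (hasFDerivAt_prodMk_right X C)
  rw [(hbC.fun_mul habs).fderiv, hbC'.fderiv]
  have hVj : ∀ j, fderiv ℝ (fun Y => b Y C * fderiv ℝ (fun C' => χ C' Y) C w j) X
      (EuclideanSpace.single j 1) =
      b X C * D2 (0, EuclideanSpace.single j 1) (w, 0) j +
        fderiv ℝ (fun C' => χ C' X) C w j *
          fderiv ℝ β (X, C) (EuclideanSpace.single j 1, 0) := by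
    intro j
    have h1 := hbX.fun_mul
      ((EuclideanSpace.proj j : EuclideanSpace ℝ (Fin n) →L[ℝ] ℝ).hasFDerivAt.comp X hV)
    have h2 := congrArg (fun L => L (EuclideanSpace.single j 1)) h1.fderiv
    simpa using h2
  simp_rw [hVj]
  have hlin : ∀ (L : EuclideanSpace ℝ (Fin n) →L[ℝ] ℝ) (u : EuclideanSpace ℝ (Fin n)),
      L u = ∑ j, u j * L (EuclideanSpace.single j 1) := by
    intro L u
    conv_lhs => rw [← (EuclideanSpace.basisFun (Fin n) ℝ).sum_repr u]
    simp
  have hV0 : fderiv ℝ (fun C' => χ C' X) C w = fderiv ℝ χ' (C, X) (w, 0) := by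
    rw [(hCd X hX).fderiv]; simp
  have e1 : fderiv ℝ β (X, C) (fderiv ℝ χ' (C, X) (w, 0), w) =
      fderiv ℝ β (X, C) (0, w) + ∑ j, fderiv ℝ χ' (C, X) (w, 0) j *
        fderiv ℝ β (X, C) (EuclideanSpace.single j 1, 0) := by
    have h1 := hlin ((fderiv ℝ β (X, C)).comp (ContinuousLinearMap.inl ℝ _ G))
      (fderiv ℝ χ' (C, X) (w, 0))
    simp only [ContinuousLinearMap.comp_apply, ContinuousLinearMap.inl_apply] at h1
    rw [← h1, ← map_add]
    simp
  -- The trace of the mixed derivative is the divergence of the velocity, by symmetry of `D2`.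
  have e2 : fderiv ℝ (fun A : EuclideanSpace ℝ (Fin n) →L[ℝ] EuclideanSpace ℝ (Fin n) =>
      A.det) (ContinuousLinearMap.id ℝ _) ((D2 (w, 0)).comp (ContinuousLinearMap.inr ℝ G _)) =
      ∑ j, D2 (0, EuclideanSpace.single j 1) (w, 0) j := by
    rw [fderiv_det_id_apply]
    refine Finset.sum_congr rfl fun j _ => ?_
    rw [ContinuousLinearMap.comp_apply, ContinuousLinearMap.inr_apply, hsymm.eq]
  rw [hV0, Finset.sum_add_distrib, ← Finset.mul_sum, ← e2]
  simp [hid X hX, hdet1, e1]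
  ring

/-! ### The relative motion and the derivative of the integral -/

theorem ContinuousLinearMap.det_ne_zero_of_isInvertible {E : Type*} [NormedAddCommGroup E]
    [NormedSpace ℝ E] {A : E →L[ℝ] E} (hA : A.IsInvertible) : A.det ≠ 0 := by
  obtain ⟨e, rfl⟩ := hA
  exact (LinearEquiv.isUnit_det' e.toLinearEquiv).ne_zero

theorem toDual_symm_apply_coord {m : ℕ} (L : EuclideanSpace ℝ (Fin m) →L[ℝ] ℝ) (c : Fin m) :
    ((InnerProductSpace.toDual ℝ (EuclideanSpace ℝ (Fin m))).symm L) c =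
      L (EuclideanSpace.single c 1) := by
  have h := InnerProductSpace.toDual_symm_apply (𝕜 := ℝ)
    (x := (EuclideanSpace.single c (1 : ℝ) : EuclideanSpace ℝ (Fin m))) (y := L)
  rw [← h, EuclideanSpace.inner_single_right]
  simp

/-- The motion relative to the configuration at the parameter `C`: it takes the position of a point
at `C` to its position at `C'`. The inverse of `φ C` is the one on `M`, so that the values are
meaningful only at the points of `φ C '' M`. -/
noncomputable def relativeMotion {m n : ℕ} (M : Set (EuclideanSpace ℝ (Fin n)))
    (φ : EuclideanSpace ℝ (Fin m) → EuclideanSpace ℝ (Fin n) → EuclideanSpace ℝ (Fin n))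
    (C C' : EuclideanSpace ℝ (Fin m)) (X : EuclideanSpace ℝ (Fin n)) :
    EuclideanSpace ℝ (Fin n) :=
  φ C' (Function.invFunOn (φ C) M X)

namespace IsParametricMotion

variable {m n : ℕ} {P : Set (EuclideanSpace ℝ (Fin m))} {M : Set (EuclideanSpace ℝ (Fin n))}
  {φ : EuclideanSpace ℝ (Fin m) → EuclideanSpace ℝ (Fin n) → EuclideanSpace ℝ (Fin n)}
  {C C' : EuclideanSpace ℝ (Fin m)}

theorem contDiffOn_apply (hφ : IsParametricMotion P M φ) (hC : C ∈ P) :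
    ContDiffOn ℝ 2 (φ C) M :=
  hφ.contDiffOn.comp (f := fun s => (C, s)) (by fun_prop) fun _ hs => ⟨hC, hs⟩

theorem relativeMotion_apply (hφ : IsParametricMotion P M φ) (hC : C ∈ P)
    {s : EuclideanSpace ℝ (Fin n)} (hs : s ∈ M) : relativeMotion M φ C C' (φ C s) = φ C' s := by
  rw [relativeMotion, (hφ.injOn C hC).leftInvOn_invFunOn hs]

theorem isOpen_image (hφ : IsParametricMotion P M φ) (hC : C ∈ P) : IsOpen (φ C '' M) :=
  ((hφ.contDiffOn_apply hC).isOpen_image_and_contDiffOn_invFunOn hφ.isOpen_region (by simp)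
    (hφ.injOn C hC) (hφ.isInvertible_fderiv C hC)).1

theorem contDiffOn_relativeMotion (hφ : IsParametricMotion P M φ) (hC : C ∈ P) :
    ContDiffOn ℝ 2 (fun q : EuclideanSpace ℝ (Fin m) × EuclideanSpace ℝ (Fin n) =>
      relativeMotion M φ C q.1 q.2) (P ×ˢ (φ C '' M)) := by
  have hσ := ((hφ.contDiffOn_apply hC).isOpen_image_and_contDiffOn_invFunOn hφ.isOpen_region
    (by simp) (hφ.injOn C hC) (hφ.isInvertible_fderiv C hC)).2
  exact hφ.contDiffOn.comp
    (f := fun q : EuclideanSpace ℝ (Fin m) × EuclideanSpace ℝ (Fin n) =>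
      (q.1, Function.invFunOn (φ C) M q.2))
    (contDiffOn_fst.prodMk (hσ.comp contDiffOn_snd fun q hq => hq.2))
    fun q hq => ⟨hq.1, Function.invFunOn_mem hq.2⟩

theorem relativeMotion_self {X : EuclideanSpace ℝ (Fin n)} (hX : X ∈ φ C '' M) :
    relativeMotion M φ C C X = X :=
  Function.invFunOn_eq hX

theorem injOn_relativeMotion (hφ : IsParametricMotion P M φ) (hC : C ∈ P) (hC' : C' ∈ P) :
    Set.InjOn (relativeMotion M φ C C') (φ C '' M) := by
  rintro _ ⟨s, hs, rfl⟩ _ ⟨s', hs', rfl⟩ h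
  rw [hφ.relativeMotion_apply hC hs, hφ.relativeMotion_apply hC hs'] at h
  rw [hφ.injOn C' hC' hs hs' h]

theorem hasFDerivAt_relativeMotion (hφ : IsParametricMotion P M φ) (hC : C ∈ P) (hC' : C' ∈ P)
    {X : EuclideanSpace ℝ (Fin n)} (hX : X ∈ φ C '' M) :
    HasFDerivAt (relativeMotion M φ C C') ((fderiv ℝ
      (fun q : EuclideanSpace ℝ (Fin m) × EuclideanSpace ℝ (Fin n) =>
        relativeMotion M φ C q.1 q.2) (C', X)).comp (ContinuousLinearMap.inr ℝ _ _)) X := by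
  have h1 := (((hφ.contDiffOn_relativeMotion hC).contDiffAt
    ((hφ.isOpen_params.prod (hφ.isOpen_image hC)).mem_nhds
      (show (C', X) ∈ _ from ⟨hC', hX⟩))).differentiableAt (by simp)).hasFDerivAt
  exact HasFDerivAt.comp X (f := fun Y => (C', Y)) h1 (hasFDerivAt_prodMk_right C' X)

theorem det_fderiv_relativeMotion_ne_zero (hφ : IsParametricMotion P M φ) (hC : C ∈ P)
    (hC' : C' ∈ P) {X : EuclideanSpace ℝ (Fin n)} (hX : X ∈ φ C '' M) :
    (fderiv ℝ (relativeMotion M φ C C') X).det ≠ 0 := by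
  obtain ⟨s, hs, rfl⟩ := hX
  have h1 := (hφ.hasFDerivAt_relativeMotion hC hC' ⟨s, hs, rfl⟩).differentiableAt.hasFDerivAt
  have h2 : HasFDerivAt (φ C) (fderiv ℝ (φ C) s) s :=
    (((hφ.contDiffOn_apply hC).contDiffAt (hφ.isOpen_region.mem_nhds hs)).differentiableAt
      (by simp)).hasFDerivAt
  -- The chain rule for `φ C' = χ C' ∘ φ C`, where `χ` is the relative motion.
  have h3 : φ C' =ᶠ[𝓝 s] relativeMotion M φ C C' ∘ φ C := by
    filter_upwards [hφ.isOpen_region.mem_nhds hs] with y hy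
    exact (hφ.relativeMotion_apply hC hy).symm
  have h4 := ((h1.comp s h2).congr_of_eventuallyEq h3).fderiv
  have h5 := ContinuousLinearMap.det_ne_zero_of_isInvertible (hφ.isInvertible_fderiv C' hC' s hs)
  rw [h4] at h5
  intro h6
  apply h5
  rw [ContinuousLinearMap.det] at h6 ⊢
  rw [ContinuousLinearMap.toLinearMap_comp, LinearMap.det_comp, h6, zero_mul]

/-- A point interior to the moving domain at `C` stays in it, together with all nearby points, for
all parameters near `C`: the map `(C', X) ↦ (χ C' X, C')`, where `χ` is the relative motion, has a
surjective derivative at `(C, X)`. -/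
theorem mem_interior_of_mem_interior (hφ : IsParametricMotion P M φ) (hC : C ∈ P)
    {Ω₀ : Set (EuclideanSpace ℝ (Fin n))} (hΩ₀M : Ω₀ ⊆ M)
    {X : EuclideanSpace ℝ (Fin n)} (hX : X ∈ interior (φ C '' Ω₀)) :
    (X, C) ∈ interior {q : EuclideanSpace ℝ (Fin n) × EuclideanSpace ℝ (Fin m) |
      q.2 ∈ P ∧ q.1 ∈ φ q.2 '' Ω₀} := by
  have hN := hφ.isOpen_image hC
  have hXN : X ∈ φ C '' M := Set.image_mono hΩ₀M (interior_subset hX)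
  set χ' : EuclideanSpace ℝ (Fin m) × EuclideanSpace ℝ (Fin n) → EuclideanSpace ℝ (Fin n) :=
    fun q => relativeMotion M φ C q.1 q.2 with hχ'
  have hstrict : HasStrictFDerivAt χ' (fderiv ℝ χ' (C, X)) (C, X) :=
    ((hφ.contDiffOn_relativeMotion hC).contDiffAt
      ((hφ.isOpen_params.prod hN).mem_nhds (show (C, X) ∈ _ from ⟨hC, hXN⟩))).hasStrictFDerivAt
      (by simp)
  have hT := hstrict.prodMk (hasStrictFDerivAt_fst (𝕜 := ℝ) (p := (C, X)))
  have hid : (fderiv ℝ χ' (C, X)).comp (ContinuousLinearMap.inr ℝ _ _) =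
      ContinuousLinearMap.id ℝ _ := by
    refine (hφ.hasFDerivAt_relativeMotion hC hC hXN).unique
      ((hasFDerivAt_id X).congr_of_eventuallyEq ?_)
    filter_upwards [hN.mem_nhds hXN] with Y hY
    exact relativeMotion_self hY
  have hmap := hT.map_nhds_eq_of_surj (by
    refine LinearMap.range_eq_top.2 fun p => ?_
    refine ⟨(p.2, p.1 - fderiv ℝ χ' (C, X) (p.2, 0)), Prod.ext ?_ rfl⟩
    have h1 := DFunLike.congr_fun hid (p.1 - fderiv ℝ χ' (C, X) (p.2, 0))
    simp only [ContinuousLinearMap.comp_apply, ContinuousLinearMap.inr_apply,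
      ContinuousLinearMap.id_apply] at h1
    have h2 : (p.2, p.1 - fderiv ℝ χ' (C, X) (p.2, 0)) =
        (p.2, (0 : EuclideanSpace ℝ (Fin n))) +
          ((0 : EuclideanSpace ℝ (Fin m)), p.1 - fderiv ℝ χ' (C, X) (p.2, 0)) := by simp
    change fderiv ℝ χ' (C, X) (p.2, p.1 - fderiv ℝ χ' (C, X) (p.2, 0)) = p.1
    rw [h2, map_add, h1]
    abel)
  have hval : χ' (C, X) = X := relativeMotion_self hXN
  rw [hval] at hmap
  rw [mem_interior_iff_mem_nhds, ← hmap, Filter.mem_map]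
  filter_upwards [(hφ.isOpen_params.prod isOpen_interior).mem_nhds
    (show (C, X) ∈ P ×ˢ interior (φ C '' Ω₀) from ⟨hC, hX⟩)] with q hq
  refine ⟨hq.1, ?_⟩
  obtain ⟨s, hs, hsq⟩ := interior_subset hq.2
  refine ⟨s, hs, ?_⟩
  simp only [hχ']
  rw [← hsq, hφ.relativeMotion_apply hC (hΩ₀M hs)]

/-- The change of variables from the domain at `C'` to the domain at `C`. -/
theorem setIntegral_image_eq (hφ : IsParametricMotion P M φ) (hC : C ∈ P) (hC' : C' ∈ P)
    {Ω₀ : Set (EuclideanSpace ℝ (Fin n))} (hΩ₀M : Ω₀ ⊆ M) (hmeas : MeasurableSet (φ C '' Ω₀))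
    (g : EuclideanSpace ℝ (Fin n) → ℝ) :
    ∫ X in φ C' '' Ω₀, g X = ∫ X in φ C '' Ω₀,
      g (relativeMotion M φ C C' X) * |(fderiv ℝ (relativeMotion M φ C C') X).det| := by
  have himg : φ C' '' Ω₀ = relativeMotion M φ C C' '' (φ C '' Ω₀) := by
    rw [Set.image_image]
    exact Set.image_congr fun s hs => (hφ.relativeMotion_apply hC (hΩ₀M hs)).symm
  have hsub : φ C '' Ω₀ ⊆ φ C '' M := Set.image_mono hΩ₀M
  rw [himg, integral_image_eq_integral_abs_det_fderiv_smul volume hmeas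
    (fun X hX => (hφ.hasFDerivAt_relativeMotion hC hC'
      (hsub hX)).differentiableAt.hasFDerivAt.hasFDerivWithinAt)
    ((hφ.injOn_relativeMotion hC hC').mono hsub)]
  simp_rw [smul_eq_mul, mul_comm]

theorem contDiffOn_parameterGradient (hφ : IsParametricMotion P M φ) (hC : C ∈ P) (c : Fin m)
    (j : Fin n) : ContDiffOn ℝ 1 (fun X => parameterGradient M φ C X c j) (φ C '' M) := by
  have hopen := hφ.isOpen_params.prod (hφ.isOpen_image hC)
  have h1 : ContDiffOn ℝ 1 (fun X => fderiv ℝ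
      (fun q : EuclideanSpace ℝ (Fin m) × EuclideanSpace ℝ (Fin n) =>
        relativeMotion M φ C q.1 q.2) (C, X)) (φ C '' M) :=
    ((hφ.contDiffOn_relativeMotion hC).fderiv_of_isOpen hopen (by norm_num)).comp
      (by fun_prop) fun X hX => ⟨hC, hX⟩
  have h2 : ContDiffOn ℝ 1 (fun X => (EuclideanSpace.proj j : EuclideanSpace ℝ (Fin n) →L[ℝ] ℝ)
      (fderiv ℝ (fun q : EuclideanSpace ℝ (Fin m) × EuclideanSpace ℝ (Fin n) =>
        relativeMotion M φ C q.1 q.2) (C, X) (EuclideanSpace.single c 1, 0))) (φ C '' M) :=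
    (EuclideanSpace.proj j : EuclideanSpace ℝ (Fin n) →L[ℝ] ℝ).contDiff.comp_contDiffOn
      (h1.clm_apply contDiffOn_const)
  refine h2.congr fun X hX => ?_
  have h3 := (((hφ.contDiffOn_relativeMotion hC).contDiffAt (hopen.mem_nhds
    (show (C, X) ∈ _ from ⟨hC, hX⟩))).differentiableAt (by simp)).hasFDerivAt
  have h4 : HasFDerivAt (fun C' => relativeMotion M φ C C' X) _ C :=
    HasFDerivAt.comp C (f := fun C' => (C', X)) h3 (hasFDerivAt_prodMk_left C X)
  change fderiv ℝ (fun C' => relativeMotion M φ C C' X) C (EuclideanSpace.single c 1) j = _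
  rw [h4.fderiv]
  simp

end IsParametricMotion

theorem corollary1 {m n : ℕ}
    (P : Set (EuclideanSpace ℝ (Fin m))) (M Ω₀ : Set (EuclideanSpace ℝ (Fin n)))
    (φ : EuclideanSpace ℝ (Fin m) → EuclideanSpace ℝ (Fin n) → EuclideanSpace ℝ (Fin n))
    (hφ : IsParametricMotion P M φ)
    (hΩ₀ : IsCompactC1Domain Ω₀) (hΩ₀M : Ω₀ ⊆ M)
    (Ω : EuclideanSpace ℝ (Fin m) → Set (EuclideanSpace ℝ (Fin n)))
    (hΩ : ∀ C ∈ P, Ω C = φ C '' Ω₀)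
    (b : EuclideanSpace ℝ (Fin n) → EuclideanSpace ℝ (Fin m) → ℝ)
    (hb : ContDiffOn ℝ 1
      (fun q : EuclideanSpace ℝ (Fin n) × EuclideanSpace ℝ (Fin m) => b q.1 q.2)
      {q | q.2 ∈ P ∧ q.1 ∈ Ω q.2})
    (C : EuclideanSpace ℝ (Fin m)) (hC : C ∈ P) :
    IntegrableOn (fun X => b X C) (Ω C) ∧
    IntegrableOn (fun X => gradient (b X) C) (Ω C) ∧
    IntegrableOn
      (fun X => matrixDot (b X C • (parameterGradient M φ C X).transpose)
        (outwardUnitNormal (Ω C) X))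
      (frontier (Ω C)) (Measure.euclideanHausdorffMeasure (n - 1)) ∧
    IntegrableOn
      (fun X => gradient (b X) C +
        matrixDivergence (fun Y => b Y C • (parameterGradient M φ C Y).transpose) X) (Ω C) ∧
    HasGradientAt (fun C' => ∫ X in Ω C', b X C')
      ((∫ X in Ω C, gradient (b X) C) +
        ∫ X in frontier (Ω C),
          matrixDot (b X C • (parameterGradient M φ C X).transpose) (outwardUnitNormal (Ω C) X)
          ∂(Measure.euclideanHausdorffMeasure (n - 1))) C ∧
    HasGradientAt (fun C' => ∫ X in Ω C', b X C')
      (∫ X in Ω C, (gradient (b X) C +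
        matrixDivergence (fun Y => b Y C • (parameterGradient M φ C Y).transpose) X)) C := by
  set β : EuclideanSpace ℝ (Fin n) × EuclideanSpace ℝ (Fin m) → ℝ := fun q => b q.1 q.2 with hβ
  set S : Set (EuclideanSpace ℝ (Fin n) × EuclideanSpace ℝ (Fin m)) :=
    {q | q.2 ∈ P ∧ q.1 ∈ Ω q.2} with hS
  have hSeq : S = {q | q.2 ∈ P ∧ q.1 ∈ φ q.2 '' Ω₀} := by
    ext q
    exact and_congr_right fun hq => by rw [hΩ _ hq]
  have hsub : Ω C ⊆ φ C '' M := by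
    rw [hΩ C hC]; exact Set.image_mono hΩ₀M
  have hdom : IsCompactC1Domain (Ω C) := by
    rw [hΩ C hC]
    exact hΩ₀.image hφ.isOpen_region hΩ₀M ((hφ.contDiffOn_apply hC).of_le (by norm_num))
      (hφ.injOn C hC) (hφ.isInvertible_fderiv C hC)
  have hcpt := hdom.isCompact
  have hint := hdom.interior_ae_eq
  have hmeas : MeasurableSet (interior (Ω C)) := isOpen_interior.measurableSet
  have hN := hφ.isOpen_image hC
  have hopen := hφ.isOpen_params.prod hN
  have hχ := hφ.contDiffOn_relativeMotion hC
  have hbC : ContDiffOn ℝ 1 (fun X => b X C) (Ω C) :=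
    hb.comp (f := fun X => (X, C)) (by fun_prop) fun X hX => ⟨hC, hX⟩
  have hSint : ∀ X ∈ interior (Ω C), (X, C) ∈ interior S := by
    intro X hX
    rw [hSeq]
    rw [hΩ C hC] at hX
    exact hφ.mem_interior_of_mem_interior hC hΩ₀M hX
  have hβd : ∀ X ∈ interior (Ω C), DifferentiableAt ℝ β (X, C) := fun X hX =>
    (hb.contDiffAt (mem_interior_iff_mem_nhds.1 (hSint X hX))).differentiableAt (by simp)
  -- The gradient of the density in the parameter is bounded and continuous inside the domain.
  have hgrad : IntegrableOn (fun X => gradient (b X) C) (interior (Ω C)) := by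
    obtain ⟨A, O, -, hO, hA⟩ := hb.exists_bound_fderiv (hcpt.prod isCompact_singleton)
      (K := Ω C ×ˢ {C}) (by rintro ⟨X, C'⟩ ⟨hX, rfl⟩; exact ⟨hC, hX⟩)
    have hL : IntegrableOn (fun X => (fderiv ℝ β (X, C)).comp (ContinuousLinearMap.inr ℝ
        (EuclideanSpace ℝ (Fin n)) (EuclideanSpace ℝ (Fin m)))) (interior (Ω C)) := by
      have : IsFiniteMeasure (volume.restrict (interior (Ω C))) := ⟨by
        rw [Measure.restrict_apply_univ]
        exact (measure_mono interior_subset).trans_lt hcpt.measure_lt_top⟩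
      refine Integrable.of_bound (C := A * ‖ContinuousLinearMap.inr ℝ
        (EuclideanSpace ℝ (Fin n)) (EuclideanSpace ℝ (Fin m))‖) ?_ ?_
      · refine ContinuousOn.aestronglyMeasurable (ContinuousOn.clm_comp ?_ continuousOn_const) hmeas
        exact ((hb.mono interior_subset).continuousOn_fderiv_of_isOpen isOpen_interior
          le_rfl).comp (by fun_prop) hSint
      · refine (ae_restrict_iff' hmeas).2 (Filter.Eventually.of_forall fun X hX => ?_)
        refine (ContinuousLinearMap.opNorm_comp_le _ _).trans ?_
        gcongr
        exact hA _ ⟨hO ⟨interior_subset hX, rfl⟩, hSint X hX⟩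
    have hL' := (InnerProductSpace.toDual ℝ (EuclideanSpace ℝ
      (Fin m))).symm.toContinuousLinearEquiv.toContinuousLinearMap.integrable_comp hL
    refine IntegrableOn.congr_fun hL' (fun X hX => ?_) hmeas
    have h1 : HasFDerivAt (b X) _ C := HasFDerivAt.comp C (f := fun C' => (X, C'))
      (hβd X hX).hasFDerivAt (hasFDerivAt_prodMk_right X C)
    rw [gradient, h1.fderiv]
    rfl
  have hT : ∀ j c, ContDiffOn ℝ 1
      (fun Y => (b Y C • (parameterGradient M φ C Y).transpose) j c) (Ω C) := fun j c =>
    hbC.mul ((hφ.contDiffOn_parameterGradient hC c j).mono hsub)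
  obtain ⟨hdot, hdiv, hdivthm⟩ := hdom.integral_matrixDivergence hT
  have hgrad' : IntegrableOn (fun X => gradient (b X) C) (Ω C) :=
    (integrableOn_congr_set_ae hint).1 hgrad
  -- The integrand after the change of variables to the domain at `C`.
  set h : EuclideanSpace ℝ (Fin m) × EuclideanSpace ℝ (Fin n) → ℝ := fun q =>
    b (relativeMotion M φ C q.1 q.2) q.1 * |(fderiv ℝ (relativeMotion M φ C q.1) q.2).det| with hh
  have hhc : ContDiffOn ℝ 1 h (P ×ˢ Ω C) := by
    refine ContDiffOn.mul ?_ (ContDiffOn.abs ?_ fun q hq =>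
      hφ.det_fderiv_relativeMotion_ne_zero hC hq.1 (hsub hq.2))
    · refine hb.comp (f := fun q : EuclideanSpace ℝ (Fin m) × EuclideanSpace ℝ (Fin n) =>
        (relativeMotion M φ C q.1 q.2, q.1)) (((hχ.of_le (by norm_num)).mono
        (Set.prod_mono le_rfl hsub)).prodMk contDiffOn_fst) fun q hq => ⟨hq.1, ?_⟩
      change relativeMotion M φ C q.1 q.2 ∈ Ω q.1
      have hq2 := hq.2
      rw [hΩ C hC] at hq2
      obtain ⟨s, hs, hsq⟩ := hq2
      rw [← hsq, hφ.relativeMotion_apply hC (hΩ₀M hs), hΩ _ hq.1]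
      exact ⟨s, hs, rfl⟩
    · refine contDiff_continuousLinearMap_det.comp_contDiffOn ?_
      have h1 : ContDiffOn ℝ 1 (fun q => (fderiv ℝ
          (fun q : EuclideanSpace ℝ (Fin m) × EuclideanSpace ℝ (Fin n) =>
            relativeMotion M φ C q.1 q.2) q).comp (ContinuousLinearMap.inr ℝ _ _))
          (P ×ˢ (φ C '' M)) :=
        (hχ.fderiv_of_isOpen hopen (by norm_num)).clm_comp contDiffOn_const
      refine (h1.mono (Set.prod_mono le_rfl hsub)).congr fun q hq => ?_
      exact (hφ.hasFDerivAt_relativeMotion hC hq.1 (hsub hq.2)).fderiv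
  obtain ⟨hLint, hLderiv⟩ := hhc.hasFDerivAt_setIntegral hφ.isOpen_params hcpt hint hC
  have hchange : (fun C' => ∫ X in Ω C', b X C') =ᶠ[𝓝 C] fun C' => ∫ X in Ω C, h (C', X) := by
    filter_upwards [hφ.isOpen_params.mem_nhds hC] with C' hC'
    have hm := hcpt.measurableSet
    rw [hΩ C hC] at hm ⊢
    rw [hΩ C' hC']
    exact hφ.setIntegral_image_eq hC hC' hΩ₀M hm fun X => b X C'
  have hpt : ∀ X ∈ interior (Ω C), (InnerProductSpace.toDual ℝ (EuclideanSpace ℝ (Fin m))).symm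
      (fderiv ℝ (fun C' => h (C', X)) C) = gradient (b X) C +
        matrixDivergence (fun Y => b Y C • (parameterGradient M φ C Y).transpose) X := by
    intro X hX
    ext c
    rw [toDual_symm_apply_coord, PiLp.add_apply, gradient, toDual_symm_apply_coord]
    exact fderiv_mul_abs_det_fderiv_apply hφ.isOpen_params hN hχ hC
      (fun Y hY => IsParametricMotion.relativeMotion_self hY) (hsub (interior_subset hX))
      (hβd X hX) (EuclideanSpace.single c 1)
  have hsecond : HasGradientAt (fun C' => ∫ X in Ω C', b X C')
      (∫ X in Ω C, (gradient (b X) C +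
        matrixDivergence (fun Y => b Y C • (parameterGradient M φ C Y).transpose) X)) C := by
    have h1 := (hLderiv.congr_of_eventuallyEq hchange)
    rw [hasFDerivAt_iff_hasGradientAt] at h1
    convert h1 using 1
    rw [← setIntegral_congr_set hint, ← setIntegral_congr_fun hmeas hpt]
    exact (InnerProductSpace.toDual ℝ
      (EuclideanSpace ℝ (Fin m))).symm.toContinuousLinearEquiv.integral_comp_comm _
  refine ⟨hbC.continuousOn.integrableOn_compact hcpt, hgrad', hdot, hgrad'.add hdiv, ?_, hsecond⟩
  rw [← hdivthm, ← integral_add hgrad' hdiv]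
  exact hsecond
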